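/- **Conventions.** "Efficient" means quantum polynomial time: uniform families of polynomial-size quantum circuits over a finite gate set, written down in polynomial time by a Turing machine from the public parameters $n,m,\kappa$ in unary; $n$ is the security parameter. $H$ is the Shannon entropy in bits. An *EFI pair* is a pair of families $(\nu_{0,n})_n,(\nu_{1,n})_n$ of mixed states that are efficiently preparable, statistically far, $\|\nu_{0,n}-\nu_{1,n}\|_1\ge 1/\mathrm{poly}(n)$ for large $n$, and computationally indistinguishable (every efficient one-bit distinguisher has negligible advantage). A *PRS* with $\kappa$-bit keys is a keyed family of efficiently preparable pure states such that, for every polynomial number $t$ of copies, $|\psi_k\rangle^{\otimes t}$ with uniformly random key $k\in\{0,1\}^{\kappa}$ is computationally indistinguishable from $t$ copies of a Haar random state. Let $m=m(n)=\omega(\log n)$ and let $\{|\psi_k\rangle\}_{k\in\{0,1\}^{\kappa}}$ be a PRS on $n+m$ qubits. Let $\rho_k=\mathrm{tr}_m|\psi_k\rangle\langle\psi_k|$ be the pseudorandom density matrices obtained by tracing out $m$ qubits, and let $\nu_0=2^{-\kappa}\sum_k\rho_k$, $\nu_1=I_n/2^n$. Let $$\Lambda_p(\rho)=\Big(1-\tfrac{3p}{4}\Big)\rho+\tfrac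 p4\sum_{\alpha\in\{x,y,z\}}\sigma^\alpha\rho\,\sigma^\alpha,\qquad 0\le p\le 1,$$ where $p$ is either an arbitrary constant, or depends on $n$ in such a way that $\Lambda_{p}^{\otimes n}$ is efficiently implementable. **(1)** Let $0<c<1$ be constant. Then $\Lambda_p^{\otimes n}(\nu_0)$, $\Lambda_p^{\otimes n}(\nu_1)$ form an EFI pair whenever the PRS has key length $\kappa=\lfloor cn\rfloor$ and, for all large $n$, $$H(\{1-\tfrac{3p}4,\tfrac p4,\tfrac p4,\tfrac p4\})\le (1-c)-\frac mn-\frac2n .$$ The same holds for key length $\kappa=\lfloor c(n+m)\rfloor$ if, for all large $n$, $$H(\{1-\tfrac{3p}4,\tfrac p4,\tfrac p4,\tfrac p4\})\le (1-c)-(1+c)\frac mn-\frac2n .$$ **(2)** Let moreover $m\le\mathrm{polylog}(n)$ for all large $n$. Then there are $C\ge0$ and $d\in\mathbb N$, depending only on $m$, such that for $c=10^{-4}$ and either choice of $\kappa$ in (1), $\Lambda_p^{\otimes n}(\nu_0)$, $\Lambda_p^{\otimes n}(\nu_1)$ form an EFI pair whenever $p<\frac14-C\,\frac{(\log n)^d}{n}$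 for all large $n$. -/

import Mathlib

open MeasureTheory Filter
open scoped Matrix

namespace NoisyEFI

/-! ### Qubits, states, elementary operations -/

/-- Computational basis labels of `N` qubits. -/
abbrev Bits (N : ℕ) : Type := Fin N → Bool

/-- Operators on the `2 ^ N`-dimensional space of `N` qubits. -/
abbrev Op (N : ℕ) : Type := Matrix (Bits N) (Bits N) ℂ

/-- The rank-one operator `|ψ⟩⟨ψ|`. -/
def ketBra {N : ℕ} (ψ : Bits N → ℂ) : Op N := Matrix.vecMulVec ψ (star ψ)

/-- The basis state `|k⟩⟨k|`. -/
def basisState {N : ℕ} (k : Bits N) : Op N := Matrix.single k k 1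

/-- The vector `|ψ⟩^{⊗ t}`; qubit `j` of copy `s` is qubit `j + N * s`. -/
def copies {N : ℕ} (t : ℕ) (ψ : Bits N → ℂ) : Bits (t * N) → ℂ :=
  fun x => ∏ s : Fin t, ψ fun j => x (finProdFinEquiv (s, j))

/-- The partial trace over the last `m` of `n + m` qubits. -/
def traceOut {n m : ℕ} (X : Op (n + m)) : Op n :=
  Matrix.of fun a b => ∑ z : Bits m, X (Fin.append a z) (Fin.append b z)

/-- The maximally mixed state `I / 2 ^ n`. -/
noncomputable def maxMixed (n : ℕ) : Op n := ((2 : ℂ) ^ n)⁻¹ • (1 : Op n)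

/-- The trace norm `‖A‖₁`, the sum of the singular values of `A`. -/
noncomputable def traceNorm {N : ℕ} (A : Op N) : ℝ :=
  ∑ i, √((Matrix.isHermitian_conjTranspose_mul_self A).eigenvalues i)

/-- The Haar measure on pure states of `N` qubits: the normalised surface measure of the unit
sphere of `ℂ ^ (2 ^ N)`. -/
noncomputable def haarState (N : ℕ) :
    Measure (Metric.sphere (0 : EuclideanSpace ℂ (Bits N)) 1) :=
  ((volume : Measure (EuclideanSpace ℂ (Bits N))).toSphere Set.univ)⁻¹ •
    (volume : Measure (EuclideanSpace ℂ (Bits N))).toSphere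

/-! ### Quantum circuits and polynomial-time quantum algorithms -/

/-- A gate: an arbitrary quantum channel on two qubits, in Kraus form. Two-qubit unitaries,
one-qubit gates, measurements, resets to `|0⟩` and random choices are all of this form. -/
structure Gate where
  /-- number of Kraus operators -/
  rank : ℕ
  /-- the Kraus operators -/
  kraus : Fin rank → Matrix (Bool × Bool) (Bool × Bool) ℂ
  /-- trace preservation -/
  complete : ∑ a, (kraus a)ᴴ * kraus a = 1

/-- A circuit over a set of `r` gate symbols: a list of instructions `(g, i, j)`, meaning
"apply gate `g` to the qubits `i` and `j`, in this order". Qubits are labelled by `ℕ`. -/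
abbrev Circuit (r : ℕ) : Type := List (Fin r × ℕ × ℕ)

/-- A (density) matrix of a register with qubits labelled by `ℕ`. Only matrices in which all but
finitely many qubits are in the state `|0⟩` occur below. -/
abbrev Register : Type := (ℕ → Bool) → (ℕ → Bool) → ℂ

/-- The bit assignment `x` with the bits at `i` and `j` replaced by `u`. -/
def setPair (x : ℕ → Bool) (i j : ℕ) (u : Bool × Bool) : ℕ → Bool :=
  Function.update (Function.update x i u.1) j u.2

/-- The action `X ↦ ∑ₐ Kₐ X Kₐ†` of a gate on the qubits `i ≠ j` of a register, tensored with the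
identity on all other qubits. An instruction with `i = j` is void. -/
def Gate.apply (G : Gate) (i j : ℕ) (X : Register) : Register :=
  if i = j then X else fun x y =>
    ∑ a, ∑ u : Bool × Bool, ∑ v : Bool × Bool,
      G.kraus a (x i, x j) u * X (setPair x i j u) (setPair y i j v) *
        star (G.kraus a (y i, y j) v)

/-- Running a circuit, first instruction first; `lib` interprets the gate symbols. -/
def run {r : ℕ} (lib : Fin r → Gate) (C : Circuit r) (X : Register) : Register :=
  C.foldl (fun Y g => (lib g.1).apply g.2.1 g.2.2 Y) X

open Classical in
/-- The register holding the `N`-qubit operator `ρ` on the qubits `0, …, N - 1` and `|0⟩` on all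
other qubits. -/
noncomputable def load {N : ℕ} (ρ : Op N) : Register := fun x y =>
  if ∀ i, N ≤ i → x i = false ∧ y i = false then ρ (fun i => x i) (fun i => y i) else 0

/-- Natural numbers in unary: `[a, b, …]` is written `1ᵃ 0 1ᵇ 0 …`. -/
def encodeParams (l : List ℕ) : List Bool :=
  l.flatMap fun a => List.replicate a true ++ [false]

/-- The description of a circuit as a word over a finite alphabet: the instruction `(g, i, j)` is
written `g 1ⁱ 0 1ʲ 0`. -/
def encodeCircuit {r : ℕ} (C : Circuit r) : List (Fin r ⊕ Bool) :=
  C.flatMap fun g =>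
    Sum.inl g.1 :: (List.replicate g.2.1 (Sum.inr true) ++ Sum.inr false ::
      (List.replicate g.2.2 (Sum.inr true) ++ [Sum.inr false]))

/-- Efficient quantum algorithms, as uniform families of polynomial-size quantum circuits.
Here `n` is the security parameter and `pp n` is a list of public parameters (`n` itself among
them). The maps `Φ n`, from `N n` to `M n` qubits, are efficient if there are a finite gate set and
a Turing machine which, on input `pp n` in unary, writes down in polynomial time a circuit over
this gate set that implements `Φ n`: it takes the input on the first `N n` qubits, all other qubits
being `|0⟩`, to the output on the first `M n` qubits, all other qubits being reset to `|0⟩`. -/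
def Efficient (pp : ℕ → List ℕ) (N M : ℕ → ℕ) (Φ : ∀ n, Op (N n) → Op (M n)) : Prop :=
  ∃ (r : ℕ) (lib : Fin r → Gate) (C : List ℕ → Circuit r),
    Nonempty (Turing.TM2ComputableInPolyTime encodeParams encodeCircuit C) ∧
    ∀ n (ρ : Op (N n)), run lib (C (pp n)) (load ρ) = load (Φ n ρ)

/-- The probability that measuring a qubit in state `σ` gives `1`. -/
def acceptProb (σ : Op 1) : ℝ := (σ (fun _ => true) (fun _ => true)).re

/-- Negligible functions. -/
def Negligible (μ : ℕ → ℝ) : Prop :=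
  ∀ c : ℕ, ∃ n₀ : ℕ, ∀ n, n₀ < n → |μ n| < 1 / (n : ℝ) ^ c

/-! ### Pseudorandom states and EFI pairs -/

/-- `ψ` is a pseudorandom state (PRS) family of `N n` qubits with keys of `κ n` bits: the states
are prepared from the key by an efficient quantum algorithm, and for any polynomial number `T n` of
copies no efficient quantum algorithm `A` with one output bit distinguishes them, for a uniformly
random key, from Haar random states. -/
structure IsPRS (pp : ℕ → List ℕ) (N κ : ℕ → ℕ)
    (ψ : ∀ n, Bits (κ n) → (Bits (N n) → ℂ)) : Prop where
  unit : ∀ n k, ∑ x, ‖ψ n k x‖ ^ 2 = 1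
  generation : ∃ G : ∀ n, Op (κ n) → Op (N n), Efficient pp κ N G ∧
    ∀ n k, G n (basisState k) = ketBra (ψ n k)
  pseudorandom : ∀ T : ℕ → ℕ, (∃ P : Polynomial ℕ, ∀ n, T n = P.eval n) →
    ∀ A : ∀ n, Op (T n * N n) → Op 1,
      Efficient pp (fun n => T n * N n) (fun _ => 1) A →
      Negligible fun n =>
        ((2 : ℝ) ^ κ n)⁻¹ * ∑ k, acceptProb (A n (ketBra (copies (T n) (ψ n k)))) -
          ∫ v, acceptProb (A n (ketBra (copies (T n) fun x => v.1 x))) ∂(haarState (N n))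

/-- EFI pairs of `N n`-qubit mixed states `ν b n`, `b ∈ {0, 1}`: efficiently generated,
statistically far (at trace-norm distance at least an inverse polynomial in the security parameter
`n`), and computationally indistinguishable. -/
structure IsEFIPair (pp : ℕ → List ℕ) (N : ℕ → ℕ) (ν : Bool → ∀ n, Op (N n)) : Prop where
  generation : ∀ b, ∃ G : ∀ n, Op 0 → Op (N n), Efficient pp (fun _ => 0) N G ∧
    ∀ n, G n 1 = ν b n
  far : ∃ d : ℕ, ∀ᶠ n : ℕ in atTop, 1 / (n : ℝ) ^ d ≤ traceNorm (ν false n - ν true n)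
  indistinguishable : ∀ A : ∀ n, Op (N n) → Op 1, Efficient pp N (fun _ => 1) A →
    Negligible fun n => acceptProb (A n (ν false n)) - acceptProb (A n (ν true n))

/-- The PRDM `ρ_k = tr_m |ψ_k⟩⟨ψ_k|` obtained by tracing out `m n` qubits of `ψ`. -/
def prdm {m κ : ℕ → ℕ} (ψ : ∀ n, Bits (κ n) → (Bits (n + m n) → ℂ)) (n : ℕ)
    (k : Bits (κ n)) : Op n :=
  traceOut (ketBra (ψ n k))

/-- The pair consisting of the PRDM for a uniformly random (unknown) key, `2^{-κ} ∑ₖ ρ_k`, and of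
the maximally mixed state. -/
noncomputable def prdmPair {m κ : ℕ → ℕ} (ψ : ∀ n, Bits (κ n) → (Bits (n + m n) → ℂ)) :
    Bool → ∀ n, Op n
  | false, n => ((2 : ℂ) ^ κ n)⁻¹ • ∑ k, prdm ψ n k
  | true, n => maxMixed n

/-! ### Local depolarizing noise -/

/-- The Pauli matrices `1, σˣ, σʸ, σᶻ`; `false` and `true` label `|0⟩` and `|1⟩`. -/
noncomputable def pauli : Fin 4 → Matrix Bool Bool ℂ :=
  ![1,
    Matrix.of fun a b => if a = b then 0 else 1,
    Matrix.of fun a b => if a = b then 0 else if b then -Complex.I else Complex.I,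
    Matrix.of fun a b => if a = b then (if b then -1 else 1) else 0]

/-- The weights of the single-qubit depolarizing channel
`Λ_p(ρ) = (1 - 3p/4) ρ + (p/4) ∑_{α = x, y, z} σᵅ ρ σᵅ`. -/
noncomputable def depolWeight (p : ℝ) : Fin 4 → ℝ := ![1 - 3 * p / 4, p / 4, p / 4, p / 4]

/-- The tensor product `σ^{s 0} ⊗ ⋯ ⊗ σ^{s (n - 1)}` of Pauli matrices. -/
noncomputable def pauliString {n : ℕ} (s : Fin n → Fin 4) : Op n :=
  Matrix.of fun x y => ∏ i, pauli (s i) (x i) (y i)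

/-- Local depolarizing noise `Λ_p^{⊗ n}`, expanded into the tensor products of the Kraus operators
of `Λ_p`. -/
noncomputable def localDepolarizing (p : ℝ) (n : ℕ) (ρ : Op n) : Op n :=
  ∑ s : Fin n → Fin 4,
    ((∏ i, depolWeight p (s i) : ℝ) : ℂ) • (pauliString s * ρ * (pauliString s)ᴴ)

/-- Shannon entropy in bits. -/
noncomputable def shannonEntropy {ι : Type*} [Fintype ι] (q : ι → ℝ) : ℝ :=
  ∑ i, Real.negMulLog (q i) / Real.log 2

/-- Depolarizing probabilities `p n ∈ [0, 1]` that are either constant (an arbitrary real), or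
vary with `n` in such a way that the noise `Λ_{p n}^{⊗ n}` is efficiently implementable. -/
def IsNoiseRate (pp : ℕ → List ℕ) (p : ℕ → ℝ) : Prop :=
  (∀ n, 0 ≤ p n ∧ p n ≤ 1) ∧
    ((∃ q, ∀ n, p n = q) ∨
      Efficient pp (fun n => n) (fun n => n) fun n => localDepolarizing (p n) n)

/-- The public parameters of the construction. -/
def params (m κ : ℕ → ℕ) (n : ℕ) : List ℕ := [n, m n, κ n]

/-- The PRDM pair remains an EFI pair after local depolarizing noise of strength `p n` on all `n`
qubits of both states. -/
def RobustEFI {m κ : ℕ → ℕ} (ψ : ∀ n, Bits (κ n) → (Bits (n + m n) → ℂ)) (p : ℕ → ℝ) : Prop :=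
  IsEFIPair (params m κ) (fun n => n) fun b n => localDepolarizing (p n) n (prdmPair ψ b n)

end NoisyEFI

/-!
A test of the pair that uses a single copy of either state is, by purification, a test of a single
copy of the PRS state: partial trace and depolarizing noise are efficient, so they can be absorbed
into the distinguisher, and the first moment of a Haar random state is the maximally mixed state,
which is mapped to `ν₁` by the partial trace and is fixed by the noise.

For the statistical distance, expand the noise into Pauli strings and call a string typical if its
probability is at least `2 ^ (-t)`, where `t = n - κ - m - 1`. The entropy of the noise is at most
`t - 1`, so by Markov's inequality the `M` typical strings have total probability at least `1 / t`,
and at least `M * 2 ^ (-t)`. Each string turns the mixture over the keys into a mixture of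
`2 ^ (κ + m)` pure states, so the projection onto the span of the vectors that belong to typical
strings accepts the maximally mixed state with probability at most
`M * 2 ^ (κ + m - n) = M * 2 ^ (-t) / 2`. It accepts the noisy mixture with at least the
probability of the typical strings, which is twice as large.

At `p = 1 / 4` the entropy of the noise is below `1 - 10⁻⁴`, with a gap that absorbs the
contribution of `m`.
-/

namespace NoisyEFI

/-! ### Stack programs -/

/-- Iterating the partial step function `f` leads from `a` to `b` in exactly `n` steps. -/
def RunsIn {σ : Type*} (f : σ → Option σ) (n : ℕ) (a b : σ) : Prop :=
  (flip Bind.bind f)^[n] (some a) = some b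

namespace RunsIn

variable {σ : Type*} {f : σ → Option σ} {n k : ℕ} {a b c : σ}

lemma zero_iff : RunsIn f 0 a b ↔ a = b := by
  simp [RunsIn]

lemma succ_iff : RunsIn f (n + 1) a b ↔ ∃ c, RunsIn f n a c ∧ f c = some b := by
  rw [RunsIn, Function.iterate_succ_apply']
  exact Option.bind_eq_some_iff

lemma single (h : f a = some b) : RunsIn f 1 a b :=
  h

lemma trans (h : RunsIn f n a b) (h' : RunsIn f k b c) : RunsIn f (n + k) a c := by
  rw [RunsIn, add_comm, Function.iterate_add_apply, h, h']

lemma of_step_eq {a' : σ} (hne : a ≠ b) (hf : f a = f a') (h : RunsIn f n a b) :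
    RunsIn f n a' b := by
  cases n with
  | zero => exact absurd (zero_iff.1 h) hne
  | succ n =>
    rw [RunsIn, Function.iterate_succ_apply] at h ⊢
    exact (congrArg _ hf.symm).trans h

lemma exists_of_simulation {τ : Type*} {g : τ → Option τ} {r : σ → τ → Prop}
    (hr : ∀ a a' b, r a a' → f a = some b → ∃ b', g a' = some b' ∧ r b b') {a' : τ} (haa' : r a a')
    (h : RunsIn f n a b) : ∃ b', RunsIn g n a' b' ∧ r b b' := by
  induction n generalizing b with
  | zero => exact ⟨a', zero_iff.2 rfl, zero_iff.1 h ▸ haa'⟩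
  | succ n ih =>
    obtain ⟨c, hac, hcb⟩ := succ_iff.1 h
    obtain ⟨c', hac', hcc'⟩ := ih hac
    obtain ⟨b', hcb', hbb'⟩ := hr c c' b hcc' hcb
    exact ⟨b', succ_iff.2 ⟨c', hac', hcb'⟩, hbb'⟩

lemma map {τ : Type*} {g : τ → Option τ} (φ : σ → τ)
    (hφ : ∀ a b, f a = some b → g (φ a) = some (φ b)) (h : RunsIn f n a b) :
    RunsIn g n (φ a) (φ b) := by
  obtain ⟨_, hrun, rfl⟩ := h.exists_of_simulation (r := fun a a' => φ a = a')
    (fun a _ b haa' hab => ⟨φ b, haa' ▸ hφ a b hab, rfl⟩) rfl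
  exact hrun

end RunsIn

section StackPrograms

open Turing Turing.TM2

section Statements

variable {K : Type} {Γ : K → Type} {Λ Λ' σ σ' : Type}

/-- The number of `push` instructions in a statement. -/
def pushCount : Stmt Γ Λ σ → ℕ
  | .push _ _ q => pushCount q + 1
  | .peek _ _ q => pushCount q
  | .pop _ _ q => pushCount q
  | .load _ q => pushCount q
  | .branch _ q₁ q₂ => pushCount q₁ + pushCount q₂
  | .goto _ => 0
  | .halt => 0

/-- A statement with its labels and states renamed, jumping to the label `exit` (if there is one)
instead of halting. -/
def renameStmt (put : σ → σ') (get : σ' → σ) (lab : Λ → Λ') (exit : Option Λ') :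
    Stmt Γ Λ σ → Stmt Γ Λ' σ'
  | .push k f q => .push k (fun v => f (get v)) (renameStmt put get lab exit q)
  | .peek k f q => .peek k (fun v x => put (f (get v) x)) (renameStmt put get lab exit q)
  | .pop k f q => .pop k (fun v x => put (f (get v) x)) (renameStmt put get lab exit q)
  | .load f q => .load (fun v => put (f (get v))) (renameStmt put get lab exit q)
  | .branch f q₁ q₂ => .branch (fun v => f (get v)) (renameStmt put get lab exit q₁)
      (renameStmt put get lab exit q₂)
  | .goto f => .goto fun v => lab (f (get v))
  | .halt => exit.elim .halt fun l => .goto fun _ => l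

/-- The renaming of configurations that goes with `renameStmt`. -/
def renameCfg (put : σ → σ') (lab : Λ → Λ') (exit : Option Λ') (c : Cfg Γ Λ σ) : Cfg Γ Λ' σ' :=
  ⟨c.l.elim exit fun l => some (lab l), put c.var, c.stk⟩

/-- A statement acting on the stacks `e k` of a larger family. -/
def liftStmt {K' : Type} (e : K' → K) : Stmt (fun k => Γ (e k)) Λ σ → Stmt Γ Λ σ
  | .push k f q => .push (e k) f (liftStmt e q)
  | .peek k f q => .peek (e k) f (liftStmt e q)
  | .pop k f q => .pop (e k) f (liftStmt e q)
  | .load f q => .load f (liftStmt e q)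
  | .branch f q₁ q₂ => .branch f (liftStmt e q₁) (liftStmt e q₂)
  | .goto f => .goto f
  | .halt => .halt

/-- The configuration `c'` on a large family of stacks restricts along `e` to `c`, and agrees with
`S` on the other stacks. -/
structure ExtendsCfg {K' : Type} (e : K' → K) (S : ∀ k, List (Γ k))
    (c : Cfg (fun k => Γ (e k)) Λ σ) (c' : Cfg Γ Λ σ) : Prop where
  label : c'.l = c.l
  var : c'.var = c.var
  stk : ∀ k, c'.stk (e k) = c.stk k
  frame : ∀ k ∉ Set.range e, c'.stk k = S k

variable [DecidableEq K]

lemma length_stepAux_le (q : Stmt Γ Λ σ) (v : σ) (S : ∀ k, List (Γ k)) (k : K) :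
    ((stepAux q v S).stk k).length ≤ (S k).length + pushCount q := by
  induction q generalizing v S with
  | push j f q ih =>
    refine (ih _ _).trans ?_
    rcases eq_or_ne k j with rfl | hkj
    · simp only [Function.update_self, List.length_cons, pushCount]
      omega
    · simp [pushCount, hkj]
  | peek j f _ ih => exact ih _ _
  | pop j f _ ih =>
    refine (ih _ _).trans ?_
    rcases eq_or_ne k j with rfl | hkj
    · simp [pushCount]
    · simp [pushCount, hkj]
  | load f _ ih => exact ih _ _
  | branch f q₁ q₂ ih₁ ih₂ =>
    have h₁ := ih₁ v S
    have h₂ := ih₂ v S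
    simp only [pushCount, stepAux]
    cases f v <;> simp only [cond_true, cond_false] <;> omega
  | goto f => simp [pushCount]
  | halt => simp [pushCount]

lemma RunsIn.length_stk_le [Fintype Λ] {M : Λ → Stmt Γ Λ σ} {n : ℕ} {a b : Cfg Γ Λ σ}
    (h : RunsIn (step M) n a b) (k : K) :
    (b.stk k).length ≤ (a.stk k).length + n * ∑ l, pushCount (M l) := by
  induction n generalizing b with
  | zero => simp [RunsIn.zero_iff.1 h]
  | succ n ih =>
    obtain ⟨⟨_ | l, v, S⟩, hac, hcb⟩ := RunsIn.succ_iff.1 h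
    · simp at hcb
    · have hpush : pushCount (M l) ≤ ∑ l, pushCount (M l) :=
        Finset.single_le_sum (f := fun l => pushCount (M l)) (fun _ _ => Nat.zero_le _)
          (Finset.mem_univ l)
      calc (b.stk k).length = ((stepAux (M l) v S).stk k).length := by
            rw [← Option.some.inj hcb]
        _ ≤ (S k).length + pushCount (M l) := length_stepAux_le _ _ _ _
        _ ≤ (a.stk k).length + n * ∑ l, pushCount (M l) + ∑ l, pushCount (M l) :=
            add_le_add (ih hac) hpush
        _ = _ := by ring

lemma stepAux_renameStmt {put : σ → σ'} {get : σ' → σ} (hget : Function.LeftInverse get put)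
    (lab : Λ → Λ') (exit : Option Λ') (q : Stmt Γ Λ σ) (v : σ) (S : ∀ k, List (Γ k)) :
    stepAux (renameStmt put get lab exit q) (put v) S =
      renameCfg put lab exit (stepAux q v S) := by
  induction q generalizing v S with
  | branch f q₁ q₂ ih₁ ih₂ =>
    simp only [renameStmt, stepAux, hget v]
    cases f v <;> simp [ih₁, ih₂]
  | goto f => simp [renameStmt, renameCfg, hget v]
  | halt => cases exit <;> rfl
  | _ => simp_all [renameStmt, hget v]

lemma RunsIn.rename {put : σ → σ'} {get : σ' → σ} (hget : Function.LeftInverse get put)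
    (lab : Λ → Λ') (exit : Option Λ') {M : Λ → Stmt Γ Λ σ} {M' : Λ' → Stmt Γ Λ' σ'}
    (hM : ∀ l, M' (lab l) = renameStmt put get lab exit (M l)) {n : ℕ} {a b : Cfg Γ Λ σ}
    (h : RunsIn (step M) n a b) :
    RunsIn (step M') n (renameCfg put lab exit a) (renameCfg put lab exit b) := by
  refine h.map (renameCfg put lab exit) fun c c' hcc' => ?_
  rcases c with ⟨_ | l, v, S⟩
  · simp at hcc'
  · rw [← Option.some.inj hcc', ← stepAux_renameStmt hget, ← hM]
    rfl

variable {K' : Type} [DecidableEq K'] {e : K' → K}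

lemma extendsCfg_stepAux (he : Function.Injective e) {S₀ : ∀ k, List (Γ k)}
    (q : Stmt (fun k => Γ (e k)) Λ σ) (v : σ) (T : ∀ k, List (Γ (e k))) (S : ∀ k, List (Γ k))
    (hT : ∀ k, S (e k) = T k) (hS : ∀ k ∉ Set.range e, S k = S₀ k) :
    ExtendsCfg e S₀ (stepAux q v T) (stepAux (liftStmt e q) v S) := by
  have update_stk {T : ∀ k, List (Γ (e k))} {S : ∀ k, List (Γ k)} (hT : ∀ k, S (e k) = T k)
      (j : K') (x : List (Γ (e j))) (k : K') :
      Function.update S (e j) x (e k) = Function.update T j x k := by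
    rcases eq_or_ne k j with rfl | hkj
    · simp
    · simp [hkj, he.ne hkj, hT]
  have update_frame {S : ∀ k, List (Γ k)} (hS : ∀ k ∉ Set.range e, S k = S₀ k) (j : K')
      (x : List (Γ (e j))) (k : K) (hk : k ∉ Set.range e) : Function.update S (e j) x k = S₀ k := by
    rw [Function.update_of_ne fun hkj => hk ⟨j, hkj.symm⟩, hS k hk]
  induction q generalizing v T S with
  | push j f q ih | pop j f q ih =>
    simp only [liftStmt, stepAux, hT]
    exact ih _ _ _ (update_stk hT j _) (update_frame hS j _)
  | peek j f q ih =>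
    simp only [liftStmt, stepAux, hT]
    exact ih _ _ _ hT hS
  | load f _ ih => exact ih _ _ _ hT hS
  | branch f q₁ q₂ ih₁ ih₂ =>
    simp only [liftStmt, stepAux]
    cases f v
    · exact ih₂ _ _ _ hT hS
    · exact ih₁ _ _ _ hT hS
  | goto f => exact ⟨rfl, rfl, hT, hS⟩
  | halt => exact ⟨rfl, rfl, hT, hS⟩

lemma RunsIn.exists_lift (he : Function.Injective e) {S : ∀ k, List (Γ k)}
    {M : Λ → Stmt (fun k => Γ (e k)) Λ σ} {n : ℕ} {a b : Cfg (fun k => Γ (e k)) Λ σ}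
    {a' : Cfg Γ Λ σ} (haa' : ExtendsCfg e S a a') (h : RunsIn (step M) n a b) :
    ∃ b', RunsIn (step fun l => liftStmt e (M l)) n a' b' ∧ ExtendsCfg e S b b' := by
  refine h.exists_of_simulation (fun c c' d hcc' hcd => ?_) haa'
  rcases c with ⟨_ | l, v, T⟩
  · simp at hcd
  · obtain ⟨_, _, S'⟩ := c'
    obtain ⟨hl, hv, hT, hS⟩ := hcc'
    dsimp only at hl hv
    subst hl hv
    exact ⟨_, rfl, Option.some.inj hcd ▸ extendsCfg_stepAux he _ _ _ _ hT hS⟩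

end Statements

/-- A finite program acting on a family of stacks with alphabets `Γ`. It is meant to be started at
the label `start` in the state `init`, and to restore this state before it halts. -/
structure Routine {K : Type} (Γ : K → Type) where
  Label : Type
  State : Type
  [fintypeLabel : Fintype Label]
  [fintypeState : Fintype State]
  start : Label
  init : State
  code : Label → Stmt Γ Label State

attribute [instance] Routine.fintypeLabel Routine.fintypeState

namespace Routine

variable {K : Type} {Γ : K → Type}

/-- The routine that does nothing. -/
def skip : Routine Γ where
  Label := Unit
  State := Unit
  start := ()
  init := ()
  code _ := .halt

/-- The routine that pushes `a` on the stack `k`. -/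
def push (k : K) (a : Γ k) : Routine Γ where
  Label := Unit
  State := Unit
  start := ()
  init := ()
  code _ := .push k (fun _ => a) .halt

/-- Sequential composition of routines. -/
def seq (R₁ R₂ : Routine Γ) : Routine Γ where
  Label := R₁.Label ⊕ R₂.Label
  State := R₁.State × R₂.State
  start := .inl R₁.start
  init := (R₁.init, R₂.init)
  code := Sum.elim
    (fun l => renameStmt (fun v => (v, R₂.init)) Prod.fst .inl (some (.inr R₂.start)) (R₁.code l))
    (fun l => renameStmt (fun v => (R₁.init, v)) Prod.snd .inr none (R₂.code l))

/-- A routine on a subfamily of the stacks, as a routine on all stacks. -/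
def lift {K' : Type} (e : K' → K) (R : Routine fun k => Γ (e k)) : Routine Γ where
  Label := R.Label
  State := R.State
  start := R.start
  init := R.init
  code l := liftStmt e (R.code l)

/-- The loop that pops symbols `x` from the stack `j` and runs `R x`, until it has popped a symbol
violating `p` or found the stack empty. -/
noncomputable def popWhile (j : K) [Fintype (Γ j)] (p : Γ j → Bool) (R : Γ j → Routine Γ) :
    Routine Γ where
  Label := Option (Σ x, (R x).Label)
  State := Option (Σ x, (R x).State)
  start := none
  init := none
  code
    | none => .pop j (fun _ a => (a.filter p).map fun x => ⟨x, (R x).init⟩)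
        (.branch Option.isSome
          (.goto fun v => v.map fun x => ⟨x.1, (R x.1).start⟩)
          .halt)
    | some ⟨x, l⟩ =>
        have : Nonempty (R x).State := ⟨(R x).init⟩
        renameStmt (fun v => some ⟨x, v⟩) (Function.invFun fun v => some ⟨x, v⟩)
          (fun l => some ⟨x, l⟩) (some none) ((R x).code l)

/-- The loop that runs `R x` for each symbol `x` on the stack `j`, emptying this stack. -/
noncomputable def popEach (j : K) [Fintype (Γ j)] (R : Γ j → Routine Γ) : Routine Γ :=
  popWhile j (fun _ => true) R

/-- The routine that empties the stack `j`. -/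
noncomputable def clear (j : K) [Fintype (Γ j)] : Routine Γ :=
  popEach j fun _ => skip

/-- The routine that moves the symbols on the stack `j` to the stack `k`, in reverse order and
relabelled by `f`. -/
noncomputable def transfer (j k : K) [Fintype (Γ j)] (f : Γ j → Γ k) : Routine Γ :=
  popEach j fun x => push k (f x)

variable [DecidableEq K] {t t' t₁ t₂ : ℕ} {S S' S'' : ∀ k, List (Γ k)}

/-- The routine `R` halts after at most `t` steps, leading from the stacks `S` to the stacks
`S'`. -/
def RunsWithin (R : Routine Γ) (t : ℕ) (S S' : ∀ k, List (Γ k)) : Prop :=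
  ∃ n ≤ t, RunsIn (step R.code) n ⟨some R.start, R.init, S⟩ ⟨none, R.init, S'⟩

lemma RunsWithin.mono {R : Routine Γ} (h : R.RunsWithin t S S') (htt' : t ≤ t') :
    R.RunsWithin t' S S' :=
  let ⟨n, hn, hrun⟩ := h
  ⟨n, hn.trans htt', hrun⟩

lemma runsWithin_skip : (skip : Routine Γ).RunsWithin 1 S S :=
  ⟨1, le_rfl, .single rfl⟩

lemma runsWithin_push {k : K} {a : Γ k} (hS' : Function.update S k (a :: S k) = S') :
    (push k a).RunsWithin 1 S S' :=
  ⟨1, le_rfl, .single (hS' ▸ rfl)⟩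

lemma RunsWithin.seq {R₁ R₂ : Routine Γ} (h₁ : R₁.RunsWithin t₁ S S')
    (h₂ : R₂.RunsWithin t₂ S' S'') : (R₁.seq R₂).RunsWithin (t₁ + t₂) S S'' := by
  obtain ⟨n₁, hn₁, hrun₁⟩ := h₁
  obtain ⟨n₂, hn₂, hrun₂⟩ := h₂
  have hfirst := hrun₁.rename (put := fun v => (v, R₂.init)) (fun _ => rfl) .inl
    (some (.inr R₂.start)) (M' := (R₁.seq R₂).code) fun _ => rfl
  have hsecond := hrun₂.rename (put := fun v => (R₁.init, v)) (fun _ => rfl) .inr none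
    (M' := (R₁.seq R₂).code) fun _ => rfl
  exact ⟨n₁ + n₂, add_le_add hn₁ hn₂, hfirst.trans hsecond⟩

lemma RunsWithin.lift {K' : Type} [DecidableEq K'] {e : K' → K} (he : Function.Injective e)
    {R : Routine fun k => Γ (e k)} {T T' : ∀ k, List (Γ (e k))} (h : R.RunsWithin t T T')
    (hS : ∀ k, S (e k) = T k) (hS' : ∀ k, S' (e k) = T' k)
    (hframe : ∀ k ∉ Set.range e, S' k = S k) : (R.lift e).RunsWithin t S S' := by
  obtain ⟨n, hn, hrun⟩ := h
  obtain ⟨⟨l, v, U⟩, hrun', hl, hv, hU, hUframe⟩ := hrun.exists_lift he (S := S)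
    (a' := ⟨some R.start, R.init, S⟩) ⟨rfl, rfl, hS, fun _ _ => rfl⟩
  obtain rfl : U = S' := by
    funext k
    by_cases hk : k ∈ Set.range e
    · obtain ⟨k, rfl⟩ := hk
      exact (hU k).trans (hS' k).symm
    · exact (hUframe k hk).trans (hframe k hk).symm
  dsimp only at hl hv
  subst hl hv
  exact ⟨n, hn, hrun'⟩

section Loops

variable {j : K} [Fintype (Γ j)] {p : Γ j → Bool} {R : Γ j → Routine Γ} {x : Γ j} {l : List (Γ j)}
  {T : ∀ k, List (Γ k)}

lemma runsWithin_popWhile_nil (hS : S j = []) : (popWhile j p R).RunsWithin 1 S S := by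
  refine ⟨1, le_rfl, .single ?_⟩
  change some _ = some _
  simp [popWhile, hS]

lemma runsWithin_popWhile_stop (hS : S j = x :: l) (hS' : Function.update S j l = S')
    (hx : p x = false) : (popWhile j p R).RunsWithin 1 S S' := by
  subst hS'
  refine ⟨1, le_rfl, .single ?_⟩
  change some _ = some _
  simp [popWhile, hS, hx]

lemma RunsWithin.popWhile_cons (hS : S j = x :: l) (hS' : Function.update S j l = S')
    (hx : p x = true) (hR : (R x).RunsWithin t₁ S' T)
    (h : (popWhile j p R).RunsWithin t₂ T S'') :
    (popWhile j p R).RunsWithin (1 + t₁ + t₂) S S'' := by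
  subst hS'
  obtain ⟨n₁, hn₁, hrun₁⟩ := hR
  obtain ⟨n₂, hn₂, hrun₂⟩ := h
  have : Nonempty (R x).State := ⟨(R x).init⟩
  have hput : Function.Injective fun v : (R x).State => (some ⟨x, v⟩ : Option (Σ x, (R x).State)) :=
    (Option.some_injective _).comp sigma_mk_injective
  have henter : RunsIn (step (popWhile j p R).code) 1 ⟨some none, none, S⟩
      ⟨some (some ⟨x, (R x).start⟩), some ⟨x, (R x).init⟩, Function.update S j l⟩ := by
    refine .single ?_
    change some _ = some _
    simp [popWhile, hS, hx]
  have hbody := hrun₁.rename (Function.leftInverse_invFun hput) (fun l => some ⟨x, l⟩) (some none)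
    (M' := (popWhile j p R).code) fun _ => rfl
  have hrest : RunsIn (step (popWhile j p R).code) n₂ ⟨some none, some ⟨x, (R x).init⟩, T⟩
      ⟨none, none, S''⟩ := by
    exact RunsIn.of_step_eq (a := ⟨some none, none, T⟩)
      (fun h => Option.some_ne_none _ (congrArg Cfg.l h)) rfl hrun₂
  exact ⟨1 + n₁ + n₂, by gcongr, (henter.trans hbody).trans hrest⟩

lemma runsWithin_popEach_nil (hS : S j = []) : (popEach j R).RunsWithin 1 S S :=
  runsWithin_popWhile_nil hS

lemma RunsWithin.popEach_cons (hS : S j = x :: l) (hS' : Function.update S j l = S')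
    (hR : (R x).RunsWithin t₁ S' T) (h : (popEach j R).RunsWithin t₂ T S'') :
    (popEach j R).RunsWithin (1 + t₁ + t₂) S S'' :=
  .popWhile_cons hS hS' rfl hR h

lemma runsWithin_clear (hS : S j = l) (hS' : Function.update S j [] = S') :
    (clear j).RunsWithin (2 * l.length + 1) S S' := by
  subst hS'
  induction l generalizing S with
  | nil =>
    have hclear : Function.update S j [] = S := hS ▸ Function.update_eq_self j S
    exact hclear.symm ▸ runsWithin_popEach_nil hS
  | cons x l ih =>
    have hrest := ih (S := Function.update S j l) (Function.update_self ..)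
    rw [Function.update_idem] at hrest
    exact (RunsWithin.popEach_cons hS rfl runsWithin_skip hrest).mono
      (by simp only [List.length_cons]; omega)

lemma runsWithin_transfer {k : K} (hjk : j ≠ k) {f : Γ j → Γ k} (hS : S j = l)
    (hS' : Function.update (Function.update S j []) k ((l.map f).reverse ++ S k) = S') :
    (transfer j k f).RunsWithin (2 * l.length + 1) S S' := by
  induction l generalizing S with
  | nil =>
    have hclear : Function.update S j [] = S := hS ▸ Function.update_eq_self j S
    obtain rfl : S = S' := by simpa [hclear] using hS'
    exact runsWithin_popEach_nil hS
  | cons x l ih =>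
    have hpush := runsWithin_push (S := Function.update S j l) (k := k) (a := f x) rfl
    refine (RunsWithin.popEach_cons hS rfl hpush (ih (by simp [hjk]) ?_)).mono
      (by simp only [List.length_cons]; omega)
    rw [← hS', Function.update_comm hjk.symm, Function.update_idem, Function.update_idem]
    simp [hjk.symm]

end Loops

end Routine

section PolyTime

lemma initList_eq (M : FinTM2) (s : List (M.Γ M.k₀)) :
    initList M s = ⟨some M.main, M.initialState, Function.update (fun _ => []) M.k₀ s⟩ := by
  refine congrArg (Cfg.mk _ _) (funext fun k => ?_)
  rcases eq_or_ne k M.k₀ with rfl | hk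
  · simp
  · simp [hk]

lemma haltList_eq (M : FinTM2) (s : List (M.Γ M.k₁)) :
    haltList M s = ⟨none, M.initialState, Function.update (fun _ => []) M.k₁ s⟩ := by
  refine congrArg (Cfg.mk _ _) (funext fun k => ?_)
  rcases eq_or_ne k M.k₁ with rfl | hk
  · simp
  · simp [hk]

namespace Routine

/-- The Turing machine that runs the routine `R` with input stack `k₀` and output stack `k₁`. -/
def toMachine {K : Type} [DecidableEq K] [Fintype K] {Γ : K → Type} (R : Routine Γ) (k₀ k₁ : K)
    [Fintype (Γ k₀)] : FinTM2 where
  k₀ := k₀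
  k₁ := k₁
  Γ := Γ
  Λ := R.Label
  main := R.start
  σ := R.State
  initialState := R.init
  m := R.code

/-- The program of a Turing machine. -/
def ofMachine (M : FinTM2) : Routine M.Γ where
  Label := M.Λ
  State := M.σ
  fintypeLabel := M.ΛFin
  fintypeState := M.σFin
  start := M.main
  init := M.initialState
  code := M.m

lemma RunsWithin.length_le {K : Type} [DecidableEq K] {Γ : K → Type} {R : Routine Γ} {t : ℕ}
    {S S' : ∀ k, List (Γ k)} (h : R.RunsWithin t S S') (k : K) :
    (S' k).length ≤ (S k).length + t * ∑ l, pushCount (R.code l) := by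
  obtain ⟨n, hn, hrun⟩ := h
  exact (hrun.length_stk_le k).trans (by gcongr)

end Routine

variable {α β A B : Type} {ea : α → List A} {eb : β → List B} {f : α → β}

lemma polyTime_of_runsWithin {K : Type} [DecidableEq K] [Finite K] {Γ : K → Type} (R : Routine Γ)
    {k₀ k₁ : K} [Finite (Γ k₀)] (iA : Γ k₀ ≃ A) (iB : Γ k₁ ≃ B) (time : Polynomial ℕ)
    (h : ∀ a, R.RunsWithin (time.eval (ea a).length)
      (Function.update (fun _ => []) k₀ ((ea a).map iA.symm))
      (Function.update (fun _ => []) k₁ ((eb (f a)).map iB.symm))) :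
    Nonempty (TM2ComputableInPolyTime ea eb f) := by
  have := Fintype.ofFinite K
  have := Fintype.ofFinite (Γ k₀)
  choose n hn hrun using h
  refine ⟨⟨⟨R.toMachine k₀ k₁, iA, iB⟩, time, fun a => ⟨⟨n a, ?_⟩, hn a⟩⟩⟩
  rw [Option.map_some, initList_eq, haltList_eq]
  exact hrun a

lemma runsWithin_ofMachine (M : TM2ComputableInPolyTime ea eb f) (a : α) :
    (Routine.ofMachine M.tm).RunsWithin (M.time.eval (ea a).length)
      (Function.update (fun _ => []) M.tm.k₀ ((ea a).map M.inputAlphabet.symm))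
      (Function.update (fun _ => []) M.tm.k₁ ((eb (f a)).map M.outputAlphabet.symm)) := by
  obtain ⟨⟨n, hrun⟩, hn⟩ := M.outputsFun a
  rw [Option.map_some, initList_eq, haltList_eq] at hrun
  exact ⟨n, hn, hrun⟩

lemma exists_polynomial_length_output_le (M : TM2ComputableInPolyTime ea eb f) :
    ∃ Q : Polynomial ℕ, ∀ a, (eb (f a)).length ≤ Q.eval (ea a).length := by
  refine ⟨.X + M.time * .C (∑ l, pushCount ((Routine.ofMachine M.tm).code l)), fun a => ?_⟩
  have hinput : (Function.update (fun k => ([] : List (M.tm.Γ k))) M.tm.k₀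
      ((ea a).map M.inputAlphabet.symm) M.tm.k₁).length ≤ (ea a).length := by
    rcases eq_or_ne M.tm.k₁ M.tm.k₀ with h | h
    · rw [h]
      simp
    · simp [h]
  have houtput := (runsWithin_ofMachine M a).length_le M.tm.k₁
  rw [Function.update_self, List.length_map] at houtput
  refine houtput.trans ((Nat.add_le_add_right hinput _).trans_eq ?_)
  simp only [Polynomial.eval_add, Polynomial.eval_mul, Polynomial.eval_X, Polynomial.eval_C]

end PolyTime

section Concat

/-- The stacks of a machine that runs two machines with stacks `K₁` and `K₂` on the same input and
concatenates their outputs. -/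
inductive ConcatStack (K₁ K₂ : Type)
  | fst (k : K₁)
  | snd (k : K₂)
  | input
  | copy
  | buffer
  | output
  deriving DecidableEq, Fintype

variable {K₁ K₂ : Type} {A B : Type} {Γ₁ : K₁ → Type} {Γ₂ : K₂ → Type}

/-- The alphabets of the stacks of the concatenation machine. -/
abbrev ConcatAlphabet (Γ₁ : K₁ → Type) (Γ₂ : K₂ → Type) (A B : Type) : ConcatStack K₁ K₂ → Type
  | .fst k => Γ₁ k
  | .snd k => Γ₂ k
  | .input => A
  | .copy => A
  | .buffer => B
  | .output => B

/-- The contents of the stacks of the concatenation machine. -/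
def concatStacks (S₁ : ∀ k, List (Γ₁ k)) (S₂ : ∀ k, List (Γ₂ k)) (input copy : List A)
    (buffer output : List B) : ∀ k, List (ConcatAlphabet Γ₁ Γ₂ A B k)
  | .fst k => S₁ k
  | .snd k => S₂ k
  | .input => input
  | .copy => copy
  | .buffer => buffer
  | .output => output

/-- The routine that pushes a symbol on the input stacks `k₁` and `k₂` of both machines. -/
def distribute {k₁ : K₁} {k₂ : K₂} (i₁ : A → Γ₁ k₁) (i₂ : A → Γ₂ k₂) (a : A) :
    Routine (ConcatAlphabet Γ₁ Γ₂ A B) :=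
  .seq (.push (.fst k₁) (i₁ a)) (.push (.snd k₂) (i₂ a))

open Routine in
/-- The routine that moves the symbols on the stack `k`, relabelled by `o`, to the top of the output
stack, preserving their order. -/
noncomputable def prependOutput [Fintype B] (k : ConcatStack K₁ K₂)
    [Fintype (ConcatAlphabet Γ₁ Γ₂ A B k)] (o : ConcatAlphabet Γ₁ Γ₂ A B k → B) :
    Routine (ConcatAlphabet Γ₁ Γ₂ A B) :=
  seq (transfer k .buffer o) (transfer .buffer .output id)

open Routine in
/-- The routine that distributes its input to the input stacks `k₁` and `k₂` of the routines `R₁`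
and `R₂`, runs both, and concatenates the contents of their output stacks `l₁` and `l₂`. -/
noncomputable def concatRoutine (R₁ : Routine Γ₁) (R₂ : Routine Γ₂) [Fintype A] [Fintype B]
    {k₁ l₁ : K₁} {k₂ l₂ : K₂} [Fintype (Γ₁ l₁)] [Fintype (Γ₂ l₂)] (i₁ : A → Γ₁ k₁) (i₂ : A → Γ₂ k₂)
    (o₁ : Γ₁ l₁ → B) (o₂ : Γ₂ l₂ → B) : Routine (ConcatAlphabet Γ₁ Γ₂ A B) :=
  seq (transfer .input .copy id) <|
  seq (popEach .copy (distribute i₁ i₂)) <|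
  seq (lift .fst R₁) <|
  seq (lift .snd R₂) <|
  seq (prependOutput (.snd l₂) o₂) <|
  prependOutput (.fst l₁) o₁

variable [DecidableEq K₁] [DecidableEq K₂] {S₁ : ∀ k, List (Γ₁ k)} {S₂ : ∀ k, List (Γ₂ k)}
  {input copy : List A} {buffer output : List B}

@[simp] lemma update_concatStacks_fst (k : K₁) (l : List (Γ₁ k)) :
    Function.update (concatStacks S₁ S₂ input copy buffer output) (.fst k) l =
      concatStacks (Function.update S₁ k l) S₂ input copy buffer output := by
  refine Function.update_eq_iff.2 ⟨?_, fun j hj => ?_⟩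
  · exact (Function.update_self k l S₁).symm
  cases j with
  | fst j => exact (Function.update_of_ne (fun h => hj (congrArg _ h)) _ _).symm
  | _ => rfl

@[simp] lemma update_concatStacks_snd (k : K₂) (l : List (Γ₂ k)) :
    Function.update (concatStacks S₁ S₂ input copy buffer output) (.snd k) l =
      concatStacks S₁ (Function.update S₂ k l) input copy buffer output := by
  refine Function.update_eq_iff.2 ⟨?_, fun j hj => ?_⟩
  · exact (Function.update_self k l S₂).symm
  cases j with
  | snd j => exact (Function.update_of_ne (fun h => hj (congrArg _ h)) _ _).symm
  | _ => rfl

@[simp] lemma update_concatStacks_input (l : List A) :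
    Function.update (concatStacks S₁ S₂ input copy buffer output) .input l =
      concatStacks S₁ S₂ l copy buffer output :=
  Function.update_eq_iff.2 ⟨rfl, fun j hj => by cases j <;> trivial⟩

@[simp] lemma update_concatStacks_copy (l : List A) :
    Function.update (concatStacks S₁ S₂ input copy buffer output) .copy l =
      concatStacks S₁ S₂ input l buffer output :=
  Function.update_eq_iff.2 ⟨rfl, fun j hj => by cases j <;> trivial⟩

@[simp] lemma update_concatStacks_buffer (l : List B) :
    Function.update (concatStacks S₁ S₂ input copy buffer output) .buffer l =
      concatStacks S₁ S₂ input copy l output :=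
  Function.update_eq_iff.2 ⟨rfl, fun j hj => by cases j <;> trivial⟩

@[simp] lemma update_concatStacks_output (l : List B) :
    Function.update (concatStacks S₁ S₂ input copy buffer output) .output l =
      concatStacks S₁ S₂ input copy buffer l :=
  Function.update_eq_iff.2 ⟨rfl, fun j hj => by cases j <;> trivial⟩

open Routine

lemma runsWithin_distribute [Fintype A] {k₁ : K₁} {k₂ : K₂} (i₁ : A → Γ₁ k₁) (i₂ : A → Γ₂ k₂)
    (S₁ : ∀ k, List (Γ₁ k)) (S₂ : ∀ k, List (Γ₂ k)) (copy : List A) :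
    (popEach .copy (distribute (B := B) i₁ i₂)).RunsWithin (3 * copy.length + 1)
      (concatStacks S₁ S₂ input copy buffer output)
      (concatStacks (Function.update S₁ k₁ ((copy.map i₁).reverse ++ S₁ k₁))
        (Function.update S₂ k₂ ((copy.map i₂).reverse ++ S₂ k₂)) input [] buffer output) := by
  induction copy generalizing S₁ S₂ with
  | nil => simpa using runsWithin_popEach_nil (j := ConcatStack.copy) rfl
  | cons a copy ih =>
    have hpush : (distribute (B := B) i₁ i₂ a).RunsWithin 2
        (concatStacks S₁ S₂ input copy buffer output)
        (concatStacks (Function.update S₁ k₁ (i₁ a :: S₁ k₁))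
          (Function.update S₂ k₂ (i₂ a :: S₂ k₂)) input copy buffer output) :=
      .seq (runsWithin_push (update_concatStacks_fst _ _))
        (runsWithin_push (update_concatStacks_snd _ _))
    have h := (RunsWithin.popEach_cons (j := ConcatStack.copy) rfl (update_concatStacks_copy _)
      hpush (ih _ _)).mono (t' := 3 * (a :: copy).length + 1)
      (by simp only [List.length_cons]; omega)
    simpa using h

lemma runsWithin_prependOutput_fst [Fintype B] {l : K₁} [Fintype (Γ₁ l)] (o : Γ₁ l → B)
    (y : List (Γ₁ l)) :
    (prependOutput (.fst l) o).RunsWithin (4 * y.length + 2)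
      (concatStacks (Function.update (fun _ => []) l y) S₂ input copy [] output)
      (concatStacks (fun _ => []) S₂ input copy [] (y.map o ++ output)) := by
  refine RunsWithin.mono (.seq
    (S' := concatStacks (fun _ => []) S₂ input copy (y.map o).reverse output)
    (runsWithin_transfer (j := ConcatStack.fst l) (l := y) (by simp) (by simp [concatStacks])
      (by simp [concatStacks]))
    (runsWithin_transfer (j := ConcatStack.buffer) (l := (y.map o).reverse) (by simp) rfl
      (by simp [concatStacks]))) ?_
  simp only [List.length_reverse, List.length_map]
  omega

lemma runsWithin_prependOutput_snd [Fintype B] {l : K₂} [Fintype (Γ₂ l)] (o : Γ₂ l → B)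
    (y : List (Γ₂ l)) :
    (prependOutput (.snd l) o).RunsWithin (4 * y.length + 2)
      (concatStacks S₁ (Function.update (fun _ => []) l y) input copy [] output)
      (concatStacks S₁ (fun _ => []) input copy [] (y.map o ++ output)) := by
  refine RunsWithin.mono (.seq
    (S' := concatStacks S₁ (fun _ => []) input copy (y.map o).reverse output)
    (runsWithin_transfer (j := ConcatStack.snd l) (l := y) (by simp) (by simp [concatStacks])
      (by simp [concatStacks]))
    (runsWithin_transfer (j := ConcatStack.buffer) (l := (y.map o).reverse) (by simp) rfl
      (by simp [concatStacks]))) ?_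
  simp only [List.length_reverse, List.length_map]
  omega

lemma runsWithin_concatRoutine [Fintype A] [Fintype B] {R₁ : Routine Γ₁} {R₂ : Routine Γ₂}
    {k₁ l₁ : K₁} {k₂ l₂ : K₂} [Fintype (Γ₁ l₁)] [Fintype (Γ₂ l₂)] {i₁ : A → Γ₁ k₁}
    {i₂ : A → Γ₂ k₂} {o₁ : Γ₁ l₁ → B} {o₂ : Γ₂ l₂ → B} {t₁ t₂ : ℕ} {x : List A}
    {y₁ : List (Γ₁ l₁)} {y₂ : List (Γ₂ l₂)}
    (h₁ : R₁.RunsWithin t₁ (Function.update (fun _ => []) k₁ (x.map i₁))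
      (Function.update (fun _ => []) l₁ y₁))
    (h₂ : R₂.RunsWithin t₂ (Function.update (fun _ => []) k₂ (x.map i₂))
      (Function.update (fun _ => []) l₂ y₂)) :
    (concatRoutine R₁ R₂ i₁ i₂ o₁ o₂).RunsWithin
      (5 * x.length + t₁ + t₂ + 4 * y₁.length + 4 * y₂.length + 6)
      (concatStacks (fun _ => []) (fun _ => []) x [] [] [])
      (concatStacks (fun _ => []) (fun _ => []) [] [] [] (y₁.map o₁ ++ y₂.map o₂)) := by
  have hcopy : (transfer .input .copy id).RunsWithin (2 * x.length + 1)
      (concatStacks (Γ₁ := Γ₁) (Γ₂ := Γ₂) (B := B) (fun _ => []) (fun _ => []) x [] [] [])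
      (concatStacks (fun _ => []) (fun _ => []) [] x.reverse [] []) :=
    runsWithin_transfer (by simp) rfl (by simp [concatStacks])
  have hrun₁ : (lift .fst R₁).RunsWithin t₁
      (concatStacks (Γ₂ := Γ₂) (A := A) (B := B) (Function.update (fun _ => []) k₁ (x.map i₁))
        (Function.update (fun _ => []) k₂ (x.map i₂)) [] [] [] [])
      (concatStacks (Function.update (fun _ => []) l₁ y₁)
        (Function.update (fun _ => []) k₂ (x.map i₂)) [] [] [] []) := by
    refine h₁.lift (fun _ _ => ConcatStack.fst.inj) (fun _ => rfl) (fun _ => rfl) fun k hk => ?_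
    cases k <;> simp [concatStacks] at hk ⊢
  have hrun₂ : (lift .snd R₂).RunsWithin t₂
      (concatStacks (Γ₁ := Γ₁) (A := A) (B := B) (Function.update (fun _ => []) l₁ y₁)
        (Function.update (fun _ => []) k₂ (x.map i₂)) [] [] [] [])
      (concatStacks (Function.update (fun _ => []) l₁ y₁)
        (Function.update (fun _ => []) l₂ y₂) [] [] [] []) := by
    refine h₂.lift (fun _ _ => ConcatStack.snd.inj) (fun _ => rfl) (fun _ => rfl) fun k hk => ?_
    cases k <;> simp [concatStacks] at hk ⊢
  have hdistribute := runsWithin_distribute (B := B) (input := []) (buffer := []) (output := [])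
    i₁ i₂ (fun _ => []) (fun _ => []) x.reverse
  simp only [List.map_reverse, List.reverse_reverse, List.append_nil, List.length_reverse]
    at hdistribute
  have hprepend₂ := runsWithin_prependOutput_snd (A := A) (input := []) (copy := []) (output := [])
    (S₁ := Function.update (fun _ => []) l₁ y₁) o₂ y₂
  have hprepend₁ := runsWithin_prependOutput_fst (A := A) (input := []) (copy := [])
    (S₂ := fun k : K₂ => ([] : List (Γ₂ k))) (output := y₂.map o₂) o₁ y₁
  rw [List.append_nil] at hprepend₂
  exact (hcopy.seq (hdistribute.seq (hrun₁.seq (hrun₂.seq (hprepend₂.seq hprepend₁))))).mono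
    (by omega)

lemma polyTime_concat [Finite A] {α β β₁ β₂ B₁ B₂ : Type} [Finite B] [Finite B₁] [Finite B₂]
    {e : α → List A} {e₁ : β₁ → List B₁} {e₂ : β₂ → List B₂} {eb : β → List B} {f₁ : α → β₁}
    {f₂ : α → β₂} {f : α → β} (j₁ : B₁ → B) (j₂ : B₂ → B)
    (hf : ∀ a, eb (f a) = (e₁ (f₁ a)).map j₁ ++ (e₂ (f₂ a)).map j₂)
    (h₁ : Nonempty (TM2ComputableInPolyTime e e₁ f₁))
    (h₂ : Nonempty (TM2ComputableInPolyTime e e₂ f₂)) :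
    Nonempty (TM2ComputableInPolyTime e eb f) := by
  obtain ⟨M₁⟩ := h₁
  obtain ⟨M₂⟩ := h₂
  obtain ⟨Q₁, hQ₁⟩ := exists_polynomial_length_output_le M₁
  obtain ⟨Q₂, hQ₂⟩ := exists_polynomial_length_output_le M₂
  have := Fintype.ofFinite A
  have := Fintype.ofFinite B
  have := Fintype.ofFinite B₁
  have := Fintype.ofFinite B₂
  have := Fintype.ofEquiv _ M₁.outputAlphabet.symm
  have := Fintype.ofEquiv _ M₂.outputAlphabet.symm
  have := M₁.tm.kFin
  have := M₂.tm.kFin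
  refine polyTime_of_runsWithin (concatRoutine (ofMachine M₁.tm) (ofMachine M₂.tm)
      M₁.inputAlphabet.symm M₂.inputAlphabet.symm (j₁ ∘ M₁.outputAlphabet) (j₂ ∘ M₂.outputAlphabet))
    (k₀ := .input) (k₁ := .output) (.refl A) (.refl B)
    (5 * .X + M₁.time + M₂.time + 4 * Q₁ + 4 * Q₂ + 6) fun a => ?_
  have hrun := runsWithin_concatRoutine (o₁ := j₁ ∘ M₁.outputAlphabet)
    (o₂ := j₂ ∘ M₂.outputAlphabet) (runsWithin_ofMachine M₁ a) (runsWithin_ofMachine M₂ a)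
  rw [List.map_map, List.map_map] at hrun
  have hnil : concatStacks (Γ₁ := M₁.tm.Γ) (Γ₂ := M₂.tm.Γ) (A := A) (B := B) (fun _ => [])
      (fun _ => []) [] [] [] [] = fun _ => [] := funext fun k => by cases k <;> rfl
  convert hrun.mono ?_ using 1
  · simp [← hnil]
  · simp [← hnil, hf, Function.comp_def]
  · have := hQ₁ a
    have := hQ₂ a
    simp only [List.length_map, Polynomial.eval_add, Polynomial.eval_mul, Polynomial.eval_X,
      Polynomial.eval_ofNat]
    omega

end Concat

/-- The circuit that applies the gate `g` to the qubits `(a, a + 1), …, (a + b - 1, a + b)`, last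
pair first. -/
def ladder {r : ℕ} (g : Fin r) : ℕ → ℕ → Circuit r
  | _, 0 => []
  | a, b + 1 => ladder g (a + 1) b ++ [(g, a, a + 1)]

lemma encodeCircuit_append {r : ℕ} (C D : Circuit r) :
    encodeCircuit (C ++ D) = encodeCircuit C ++ encodeCircuit D := List.flatMap_append

section Ladder

/-- The stacks of the machine that writes down ladders: besides input and output, unary counters
for the first qubit and the length of the ladder, and an auxiliary one. -/
inductive LadderStack
  | input
  | start
  | count
  | aux
  | output
  deriving DecidableEq

instance : Fintype LadderStack :=
  ⟨{.input, .start, .count, .aux, .output}, fun k => by cases k <;> decide⟩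

/-- The alphabets of the stacks of the ladder machine. -/
abbrev LadderAlphabet (r : ℕ) : LadderStack → Type
  | .input => Bool
  | .start => Unit
  | .count => Unit
  | .aux => Unit
  | .output => Fin r ⊕ Bool

variable {r : ℕ} {input : List Bool} {start count aux : ℕ} {output : List (Fin r ⊕ Bool)}

/-- The contents of the stacks of the ladder machine. -/
def ladderStacks (input : List Bool) (start count aux : ℕ) (output : List (Fin r ⊕ Bool)) :
    ∀ k, List (LadderAlphabet r k)
  | .input => input
  | .start => .replicate start ()
  | .count => .replicate count ()
  | .aux => .replicate aux ()
  | .output => output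

lemma update_ladderStacks_input (l : List Bool) :
    Function.update (ladderStacks input start count aux output) .input l =
      ladderStacks l start count aux output :=
  Function.update_eq_iff.2 ⟨rfl, fun j hj => by cases j <;> trivial⟩

lemma update_ladderStacks_start (a : ℕ) :
    Function.update (ladderStacks input start count aux output) .start (.replicate a ()) =
      ladderStacks input a count aux output :=
  Function.update_eq_iff.2 ⟨rfl, fun j hj => by cases j <;> trivial⟩

lemma update_ladderStacks_count (a : ℕ) :
    Function.update (ladderStacks input start count aux output) .count (.replicate a ()) =
      ladderStacks input start a aux output :=
  Function.update_eq_iff.2 ⟨rfl, fun j hj => by cases j <;> trivial⟩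

lemma update_ladderStacks_aux (a : ℕ) :
    Function.update (ladderStacks input start count aux output) .aux (.replicate a ()) =
      ladderStacks input start count a output :=
  Function.update_eq_iff.2 ⟨rfl, fun j hj => by cases j <;> trivial⟩

lemma update_ladderStacks_output (l : List (Fin r ⊕ Bool)) :
    Function.update (ladderStacks input start count aux output) .output l =
      ladderStacks input start count aux l :=
  Function.update_eq_iff.2 ⟨rfl, fun j hj => by cases j <;> trivial⟩

open Routine

/-- The loop that pops the unary number on top of the input, running `R` for each unit. -/
noncomputable def scanParam (R : Routine (LadderAlphabet r)) : Routine (LadderAlphabet r) :=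
  popWhile .input id fun _ => R

lemma headD_add_length_encodeParams_tail_le (l : List ℕ) :
    l.headD 0 + (encodeParams l.tail).length ≤ (encodeParams l).length := by
  cases l with
  | nil => rfl
  | cons a l =>
    simp only [encodeParams, List.headD_cons, List.tail_cons, List.flatMap_cons,
      List.length_append, List.length_replicate]
    omega

lemma runsWithin_scanParam {R : Routine (LadderAlphabet r)}
    (F : List Bool → ℕ → ∀ k, List (LadderAlphabet r k)) (hinput : ∀ i v, F i v .input = i)
    (hupdate : ∀ i j v, Function.update (F i v) .input j = F j v)
    (hR : ∀ i v, R.RunsWithin 1 (F i v) (F i (v + 1))) (l : List ℕ) (v : ℕ) :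
    (scanParam R).RunsWithin (2 * l.headD 0 + 1) (F (encodeParams l) v)
      (F (encodeParams l.tail) (v + l.headD 0)) := by
  cases l with
  | nil => exact runsWithin_popWhile_nil (hinput _ _)
  | cons a l =>
    simp only [encodeParams, List.flatMap_cons, List.tail_cons, List.headD_cons]
    induction a generalizing v with
    | zero => exact runsWithin_popWhile_stop (hinput _ _) (hupdate _ _ _) rfl
    | succ a ih =>
      have h := RunsWithin.popWhile_cons (hinput _ _) (hupdate _ _ _) rfl (hR _ _) (ih (v + 1))
      rw [add_assoc v, add_comm 1 a] at h
      exact h.mono (t' := 2 * (a + 1) + 1) (by omega)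

lemma runsWithin_scanParam_start (l : List ℕ) :
    (scanParam (push .start ())).RunsWithin (2 * l.headD 0 + 1)
      (ladderStacks (encodeParams l) start count aux output)
      (ladderStacks (encodeParams l.tail) (start + l.headD 0) count aux output) :=
  runsWithin_scanParam (fun i v => ladderStacks i v count aux output) (fun _ _ => rfl)
    (fun _ _ _ => update_ladderStacks_input _)
    (fun _ v => runsWithin_push (update_ladderStacks_start (v + 1))) l start

lemma runsWithin_scanParam_count (l : List ℕ) :
    (scanParam (push .count ())).RunsWithin (2 * l.headD 0 + 1)
      (ladderStacks (encodeParams l) start count aux output)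
      (ladderStacks (encodeParams l.tail) start (count + l.headD 0) aux output) :=
  runsWithin_scanParam (fun i v => ladderStacks i start v aux output) (fun _ _ => rfl)
    (fun _ _ _ => update_ladderStacks_input _)
    (fun _ v => runsWithin_push (update_ladderStacks_count (v + 1))) l count

lemma runsWithin_scanParam_skip (l : List ℕ) :
    (scanParam skip).RunsWithin (2 * l.headD 0 + 1)
      (ladderStacks (encodeParams l) start count aux output)
      (ladderStacks (encodeParams l.tail) start count aux output) :=
  runsWithin_scanParam (fun i _ => ladderStacks i start count aux output) (fun _ _ => rfl)
    (fun _ _ _ => update_ladderStacks_input _) (fun _ _ => runsWithin_skip) l 0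

/-- The loop that moves the counter `j` to the counter `k`, represented by its pushing routine, and
writes it on the output. -/
noncomputable def moveAndWrite (j k : LadderStack) [Fintype (LadderAlphabet r j)]
    (a : LadderAlphabet r k) : Routine (LadderAlphabet r) :=
  popEach j fun _ => seq (push k a) (push .output (.inr true))

lemma runsWithin_moveAndWrite_start_aux :
    (moveAndWrite (r := r) .start .aux ()).RunsWithin (3 * start + 1)
      (ladderStacks input start count aux output)
      (ladderStacks input 0 count (aux + start) (.replicate start (.inr true) ++ output)) := by
  induction start generalizing aux output with
  | zero => exact runsWithin_popEach_nil rfl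
  | succ start ih =>
    have hhead : ladderStacks input (start + 1) count aux output .start =
      () :: List.replicate start () := rfl
    have h := RunsWithin.popEach_cons hhead (update_ladderStacks_start start)
      (.seq (runsWithin_push (update_ladderStacks_aux (aux + 1)))
        (runsWithin_push (update_ladderStacks_output (.inr true :: output)))) ih
    rw [add_assoc aux, add_comm 1 start, List.append_cons, ← List.replicate_succ'] at h
    exact h.mono (t' := 3 * (start + 1) + 1) (by omega)

lemma runsWithin_moveAndWrite_aux_start :
    (moveAndWrite (r := r) .aux .start ()).RunsWithin (3 * aux + 1)
      (ladderStacks input start count aux output)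
      (ladderStacks input (start + aux) count 0 (.replicate aux (.inr true) ++ output)) := by
  induction aux generalizing start output with
  | zero => exact runsWithin_popEach_nil rfl
  | succ aux ih =>
    have hhead : ladderStacks input start count (aux + 1) output .aux =
      () :: List.replicate aux () := rfl
    have h := RunsWithin.popEach_cons hhead (update_ladderStacks_aux aux)
      (.seq (runsWithin_push (update_ladderStacks_start (start + 1)))
        (runsWithin_push (update_ladderStacks_output (.inr true :: output)))) ih
    rw [add_assoc start, add_comm 1 aux, List.append_cons, ← List.replicate_succ'] at h
    exact h.mono (t' := 3 * (aux + 1) + 1) (by omega)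

/-- The routine that writes the instruction `(g, a, a + 1)`, with `a` the counter `start`, in front
of the output, and increments this counter. -/
noncomputable def writeStep (g : Fin r) : Routine (LadderAlphabet r) :=
  seq (push .output (.inr false)) <|
  seq (push .output (.inr true)) <|
  seq (moveAndWrite .start .aux ()) <|
  seq (push .output (.inr false)) <|
  seq (moveAndWrite .aux .start ()) <|
  seq (push .output (.inl g)) <|
  push .start ()

lemma runsWithin_writeStep (g : Fin r) :
    (writeStep g).RunsWithin (6 * start + 7) (ladderStacks input start count 0 output)
      (ladderStacks input (start + 1) count 0
        (encodeCircuit [(g, start, start + 1)] ++ output)) := by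
  have hpush (a : Fin r ⊕ Bool) (start aux : ℕ) (output : List (Fin r ⊕ Bool)) :
      (push .output a).RunsWithin 1 (ladderStacks input start count aux output)
        (ladderStacks input start count aux (a :: output)) :=
    runsWithin_push (update_ladderStacks_output (a :: output))
  have hincr (output : List (Fin r ⊕ Bool)) :
      (push .start ()).RunsWithin 1 (ladderStacks input start count 0 output)
        (ladderStacks input (start + 1) count 0 output) :=
    runsWithin_push (update_ladderStacks_start (start + 1))
  have hout : encodeCircuit [(g, start, start + 1)] ++ output =
      .inl g :: (.replicate start (.inr true) ++ .inr false ::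
        (.replicate start (.inr true) ++ .inr true :: .inr false :: output)) := by
    simp [encodeCircuit, List.replicate_succ']
  rw [hout]
  have hmove := runsWithin_moveAndWrite_start_aux (input := input) (start := start)
    (count := count) (aux := 0) (output := .inr true :: .inr false :: output)
  have hback := runsWithin_moveAndWrite_aux_start (input := input) (start := 0)
    (count := count) (aux := start)
    (output := .inr false :: (.replicate start (.inr true) ++ .inr true :: .inr false :: output))
  rw [zero_add] at hmove hback
  exact ((hpush _ _ _ _).seq <| (hpush _ _ _ _).seq <| hmove.seq <| (hpush _ _ _ _).seq <|
    hback.seq <| (hpush _ _ _ _).seq (hincr _)).mono (by omega)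

/-- The routine that, given the counters `start = a` and `count = b`, writes the circuit
`ladder g a b` in front of the output and empties these counters and the rest of the input. -/
noncomputable def writeLadder (g : Fin r) : Routine (LadderAlphabet r) :=
  seq (popEach .count fun _ => writeStep g) (seq (clear .start) (clear .input))

lemma runsWithin_popEach_writeStep (g : Fin r) {L : ℕ} (hL : start + count ≤ L) :
    (popEach .count fun _ => writeStep g).RunsWithin (count * (6 * L + 8) + 1)
      (ladderStacks input start count 0 output)
      (ladderStacks input (start + count) 0 0
        (encodeCircuit (ladder g start count) ++ output)) := by
  induction count generalizing start output with
  | zero => exact (runsWithin_popEach_nil rfl).mono (by omega)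
  | succ count ih =>
    have hhead : ladderStacks input start (count + 1) 0 output .count =
      () :: List.replicate count () := rfl
    have h := RunsWithin.popEach_cons hhead (update_ladderStacks_count count)
      (runsWithin_writeStep g) (ih (start := start + 1) (by omega))
    rw [← List.append_assoc, ← encodeCircuit_append, add_assoc start, add_comm 1 count] at h
    exact h.mono (t' := (count + 1) * (6 * L + 8) + 1) (by rw [add_mul]; omega)

lemma runsWithin_writeLadder (g : Fin r) {L : ℕ} (hL : start + count ≤ L)
    (hinput : input.length ≤ L) :
    (writeLadder g).RunsWithin (L * (6 * L + 8) + 4 * L + 3)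
      (ladderStacks input start count 0 [])
      (ladderStacks [] 0 0 0 (encodeCircuit (ladder g start count))) := by
  have hwrite := runsWithin_popEach_writeStep (input := input) (output := []) g hL
  rw [List.append_nil] at hwrite
  have hmul : count * (6 * L + 8) ≤ L * (6 * L + 8) := by gcongr; omega
  have hclear := (runsWithin_clear (j := LadderStack.start) rfl
    (update_ladderStacks_start (input := input) (start := start + count) (count := 0) (aux := 0)
      (output := encodeCircuit (ladder g start count)) 0)).seq
    (runsWithin_clear (j := LadderStack.input) rfl (update_ladderStacks_input []))
  refine (hwrite.seq hclear).mono ?_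
  simp only [ladderStacks, List.length_replicate]
  omega

open Polynomial in
lemma polyTime_ladder (g : Fin r) {R : Routine (LadderAlphabet r)} {a b : List ℕ → ℕ}
    {rest : List ℕ → List ℕ}
    (hR : ∀ l, R.RunsWithin (6 * (encodeParams l).length + 3)
      (ladderStacks (encodeParams l) 0 0 0 [])
      (ladderStacks (encodeParams (rest l)) (a l) (b l) 0 []))
    (hab : ∀ l, a l + b l ≤ (encodeParams l).length)
    (hrest : ∀ l, (encodeParams (rest l)).length ≤ (encodeParams l).length) :
    Nonempty (TM2ComputableInPolyTime encodeParams encodeCircuit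
      fun l => ladder g (a l) (b l)) := by
  refine polyTime_of_runsWithin (seq R (writeLadder g)) (k₀ := .input) (k₁ := .output)
    (.refl Bool) (.refl (Fin r ⊕ Bool)) (6 * X + 3 + (X * (6 * X + 8) + 4 * X + 3)) fun l => ?_
  have hempty : (fun _ => [] : ∀ k, List (LadderAlphabet r k)) = ladderStacks [] 0 0 0 [] := by
    funext k
    cases k <;> rfl
  rw [hempty, update_ladderStacks_input, update_ladderStacks_output]
  simp only [Equiv.refl_symm, Equiv.coe_refl, List.map_id]
  refine ((hR l).seq (runsWithin_writeLadder g (hab l) (hrest l))).mono (le_of_eq ?_)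
  simp

lemma polyTime_ladder_first (g : Fin r) :
    Nonempty (TM2ComputableInPolyTime encodeParams encodeCircuit
      fun l => ladder g 0 (l.headD 0)) := by
  refine polyTime_ladder g (R := scanParam (push .count ())) (rest := List.tail)
    (fun l => ?_) (fun l => ?_) fun l => ?_
  all_goals have hl := headD_add_length_encodeParams_tail_le l
  · have h := runsWithin_scanParam_count (r := r) (start := 0) (count := 0) (aux := 0)
      (output := []) l
    rw [zero_add] at h
    exact h.mono (by omega)
  · omega
  · omega

lemma polyTime_ladder_first_second (g : Fin r) :
    Nonempty (TM2ComputableInPolyTime encodeParams encodeCircuit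
      fun l => ladder g (l.headD 0) (l.tail.headD 0)) := by
  refine polyTime_ladder g (R := seq (scanParam (push .start ())) (scanParam (push .count ())))
    (rest := fun l => l.tail.tail) (fun l => ?_) (fun l => ?_) fun l => ?_
  all_goals
    have hl := headD_add_length_encodeParams_tail_le l
    have hl' := headD_add_length_encodeParams_tail_le l.tail
  · have h := (runsWithin_scanParam_start (r := r) (start := 0) (count := 0) (aux := 0)
      (output := []) l).seq (runsWithin_scanParam_count l.tail)
    rw [zero_add, zero_add] at h
    exact h.mono (by omega)
  · omega
  · omega

lemma polyTime_ladder_third (g : Fin r) :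
    Nonempty (TM2ComputableInPolyTime encodeParams encodeCircuit
      fun l => ladder g 0 (l.tail.tail.headD 0)) := by
  refine polyTime_ladder g
    (R := seq (scanParam skip) (seq (scanParam skip) (scanParam (push .count ()))))
    (rest := fun l => l.tail.tail.tail) (fun l => ?_) (fun l => ?_) fun l => ?_
  all_goals
    have hl := headD_add_length_encodeParams_tail_le l
    have hl' := headD_add_length_encodeParams_tail_le l.tail
    have hl'' := headD_add_length_encodeParams_tail_le l.tail.tail
  · have h := (runsWithin_scanParam_skip (r := r) (start := 0) (count := 0) (aux := 0)
      (output := []) l).seq ((runsWithin_scanParam_skip l.tail).seq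
      (runsWithin_scanParam_count l.tail.tail))
    rw [zero_add] at h
    exact h.mono (by omega)
  · omega
  · omega

end Ladder

end StackPrograms

lemma Gate.apply_add (G : Gate) (i j : ℕ) (X Y : Register) :
    G.apply i j (X + Y) = G.apply i j X + G.apply i j Y := by
  unfold Gate.apply
  split_ifs
  · rfl
  · funext x y
    simp only [Pi.add_apply, mul_add, add_mul, Finset.sum_add_distrib]

lemma Gate.apply_smul (G : Gate) (i j : ℕ) (c : ℂ) (X : Register) :
    G.apply i j (c • X) = c • G.apply i j X := by
  unfold Gate.apply
  split_ifs
  · rfl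
  · funext x y
    simp only [Pi.smul_apply, smul_eq_mul, Finset.mul_sum]
    refine Finset.sum_congr rfl fun _ _ => Finset.sum_congr rfl fun _ _ =>
      Finset.sum_congr rfl fun _ _ => ?_
    ring

lemma run_append {r : ℕ} (lib : Fin r → Gate) (C D : Circuit r) (X : Register) :
    run lib (C ++ D) X = run lib D (run lib C X) := List.foldl_append

lemma run_add {r : ℕ} (lib : Fin r → Gate) (C : Circuit r) (X Y : Register) :
    run lib C (X + Y) = run lib C X + run lib C Y := by
  induction C generalizing X Y with
  | nil => rfl
  | cons g C ih =>
    change run lib C ((lib g.1).apply g.2.1 g.2.2 (X + Y)) = _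
    rw [Gate.apply_add, ih]
    rfl

lemma run_smul {r : ℕ} (lib : Fin r → Gate) (C : Circuit r) (c : ℂ) (X : Register) :
    run lib C (c • X) = c • run lib C X := by
  induction C generalizing X with
  | nil => rfl
  | cons g C ih =>
    change run lib C ((lib g.1).apply g.2.1 g.2.2 (c • X)) = _
    rw [Gate.apply_smul, ih]
    rfl

lemma run_map {r s : ℕ} (lib : Fin s → Gate) (f : Fin r → Fin s) (C : Circuit r)
    (X : Register) :
    run lib (C.map fun g => (f g.1, g.2)) X = run (fun g => lib (f g)) C X := by
  unfold run
  rw [List.foldl_map]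

lemma load_add {N : ℕ} (ρ σ : Op N) : load (ρ + σ) = load ρ + load σ := by
  funext x y
  simp only [load, Pi.add_apply, Matrix.add_apply]
  split_ifs <;> simp

lemma load_smul {N : ℕ} (c : ℂ) (ρ : Op N) : load (c • ρ) = c • load ρ := by
  funext x y
  simp only [load, Pi.smul_apply, Matrix.smul_apply]
  split_ifs <;> simp

/-- The label of a register that continues the bit string `a` by zeros: `load` is supported on
such labels. -/
def extendBits {N : ℕ} (a : Bits N) : ℕ → Bool := fun i => if h : i < N then a ⟨i, h⟩ else false

lemma load_extendBits {N : ℕ} (ρ : Op N) (a b : Bits N) :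
    load ρ (extendBits a) (extendBits b) = ρ a b := by
  have h : ∀ i, N ≤ i → extendBits a i = false ∧ extendBits b i = false := fun i hi => by
    simp [extendBits, hi.not_gt]
  rw [load, if_pos h]
  simp [extendBits]

lemma load_injective {N : ℕ} : Function.Injective (load : Op N → Register) := by
  intro ρ σ h
  ext a b
  rw [← load_extendBits ρ, h, load_extendBits]

lemma Efficient.exists_linear {pp : ℕ → List ℕ} {N M : ℕ → ℕ} {Φ : ∀ n, Op (N n) → Op (M n)}
    (h : Efficient pp N M Φ) :
    ∃ L : ∀ n, Op (N n) →ₗ[ℂ] Op (M n), ∀ n ρ, Φ n ρ = L n ρ := by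
  obtain ⟨r, lib, C, -, hC⟩ := h
  refine ⟨fun n => ⟨⟨Φ n, fun ρ σ => load_injective ?_⟩, fun c ρ => load_injective ?_⟩,
    fun n ρ => rfl⟩
  · rw [load_add, ← hC, ← hC, ← hC, load_add, run_add]
  · rw [RingHom.id_apply, load_smul, ← hC, ← hC, load_smul, run_smul]

lemma encodeCircuit_map {r s : ℕ} (f : Fin r → Fin s) (C : Circuit r) :
    encodeCircuit (C.map fun g => (f g.1, g.2)) = (encodeCircuit C).map (Sum.map f id) := by
  induction C with
  | nil => rfl
  | cons g C ih =>
    simp only [encodeCircuit, List.map_cons, List.flatMap_cons, List.map_append] at ih ⊢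
    rw [ih]
    simp

lemma Efficient.comp {pp : ℕ → List ℕ} {N M L : ℕ → ℕ} {Φ : ∀ n, Op (N n) → Op (M n)}
    {Ψ : ∀ n, Op (M n) → Op (L n)} (hΨ : Efficient pp M L Ψ) (hΦ : Efficient pp N M Φ) :
    Efficient pp N L fun n ρ => Ψ n (Φ n ρ) := by
  obtain ⟨r, libΦ, C, hC, hrunC⟩ := hΦ
  obtain ⟨s, libΨ, D, hD, hrunD⟩ := hΨ
  refine ⟨r + s, Fin.append libΦ libΨ, fun l => ((C l).map fun g => (Fin.castAdd s g.1, g.2)) ++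
    (D l).map fun g => (Fin.natAdd r g.1, g.2), ?_, fun n ρ => ?_⟩
  · refine polyTime_concat (Sum.map (Fin.castAdd s) id) (Sum.map (Fin.natAdd r) id)
      (fun l => ?_) hC hD
    rw [encodeCircuit_append, encodeCircuit_map, encodeCircuit_map]
  · rw [run_append, run_map, run_map]
    simp only [Fin.append_left, Fin.append_right]
    rw [hrunC, hrunD]

/-- The two-qubit gate acting by the given Kraus operators on its first qubit only. -/
def oneQubitGate {k : ℕ} (K : Fin k → Matrix Bool Bool ℂ) (hK : ∑ a, (K a)ᴴ * K a = 1) :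
    Gate where
  rank := k
  kraus a := Matrix.of fun x u => K a x.1 u.1 * (1 : Matrix Bool Bool ℂ) x.2 u.2
  complete := by
    ext ⟨x, x'⟩ ⟨y, y'⟩
    have h := congrFun (congrFun hK x) y
    simp only [Matrix.sum_apply, Matrix.mul_apply, Matrix.conjTranspose_apply,
      Matrix.of_apply, Fintype.sum_prod_type, Fintype.sum_bool] at h ⊢
    have e : (1 : Matrix (Bool × Bool) (Bool × Bool) ℂ) (x, x') (y, y') =
        (1 : Matrix Bool Bool ℂ) x y * (1 : Matrix Bool Bool ℂ) x' y' := by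
      simp only [Matrix.one_apply, Prod.mk.injEq]
      split_ifs <;> simp_all
    rw [e, ← h]
    cases x' <;> cases y' <;> simp

/-- The kernel of the channel with the given Kraus operators. -/
def krausKernel {k : ℕ} (K : Fin k → Matrix Bool Bool ℂ) (x y u v : Bool) : ℂ :=
  ∑ a, K a x u * star (K a y v)

lemma oneQubitGate_apply {k : ℕ} (K : Fin k → Matrix Bool Bool ℂ)
    (hK : ∑ a, (K a)ᴴ * K a = 1) {i j : ℕ} (hij : i ≠ j) (X : Register) (x y : ℕ → Bool) :
    (oneQubitGate K hK).apply i j X x y = ∑ u, ∑ v, krausKernel K (x i) (y i) u v *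
      X (Function.update x i u) (Function.update y i v) := by
  have hset : ∀ (x : ℕ → Bool) u, setPair x i j (u, x j) = Function.update x i u := fun x u => by
    funext l
    rcases eq_or_ne l j with rfl | hl
    · simp [setPair, hij.symm]
    · simp [setPair, hl]
  unfold Gate.apply
  rw [if_neg hij]
  simp only [krausKernel, oneQubitGate, Matrix.of_apply, Fintype.sum_prod_type,
    Matrix.one_apply, ← hset]
  generalize x j = p
  generalize y j = q
  simp only [Finset.sum_mul, Fintype.sum_bool, ← Finset.sum_add_distrib]
  refine Finset.sum_congr rfl fun a _ => ?_
  cases p <;> cases q <;> simp <;> ring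

/-- Replacing the bits `a, …, a + b - 1`. -/
def setBits {b : ℕ} (x : ℕ → Bool) (a : ℕ) (u : Bits b) : ℕ → Bool := fun i =>
  if h : a ≤ i ∧ i < a + b then u ⟨i - a, by omega⟩ else x i

lemma setBits_zero (x : ℕ → Bool) (a : ℕ) (u : Bits 0) : setBits x a u = x := by
  funext i
  simp only [setBits]
  rw [dif_neg (by omega)]

lemma setBits_cons {b : ℕ} (x : ℕ → Bool) (a : ℕ) (c : Bool) (u : Bits b) :
    setBits (b := b + 1) x a (Fin.cons c u) = setBits (Function.update x a c) (a + 1) u := by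
  funext i
  simp only [setBits]
  rcases lt_trichotomy i a with h | h | h
  · rw [dif_neg (by omega), dif_neg (by omega), Function.update_of_ne h.ne]
  · subst h
    rw [dif_pos (by omega), dif_neg (by omega), Function.update_self]
    have : (⟨i - i, by omega⟩ : Fin (b + 1)) = 0 := by ext; simp
    rw [this, Fin.cons_zero]
  · by_cases h2 : i < a + (b + 1)
    · rw [dif_pos (by omega), dif_pos (by omega)]
      have : (⟨i - a, by omega⟩ : Fin (b + 1)) = Fin.succ ⟨i - (a + 1), by omega⟩ := by
        ext; simp; omega
      rw [this, Fin.cons_succ]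
    · rw [dif_neg (by omega), dif_neg (by omega), Function.update_of_ne h.ne']

lemma run_ladder {k : ℕ} (K : Fin k → Matrix Bool Bool ℂ) (hK : ∑ a, (K a)ᴴ * K a = 1)
    (a b : ℕ) (X : Register) (x y : ℕ → Bool) :
    run (fun _ : Fin 1 => oneQubitGate K hK) (ladder 0 a b) X x y =
      ∑ u : Bits b, ∑ v : Bits b, (∏ i : Fin b, krausKernel K (x (a + i)) (y (a + i)) (u i) (v i)) *
        X (setBits x a u) (setBits y a v) := by
  induction b generalizing a x y with
  | zero => simp [ladder, run, setBits_zero]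
  | succ b ih =>
    have h := oneQubitGate_apply K hK (Nat.succ_ne_self a).symm
      (run (fun _ : Fin 1 => oneQubitGate K hK) (ladder 0 (a + 1) b) X) x y
    rw [ladder, run_append]
    change (oneQubitGate K hK).apply a (a + 1) _ x y = _
    rw [h, ← (Fin.consEquiv fun _ => Bool).sum_comp, Fintype.sum_prod_type]
    refine Finset.sum_congr rfl fun c _ => ?_
    simp only [ih, Finset.mul_sum]
    rw [Finset.sum_comm]
    refine Finset.sum_congr rfl fun u _ => ?_
    rw [← (Fin.consEquiv fun _ => Bool).sum_comp, Fintype.sum_prod_type]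
    refine Finset.sum_congr rfl fun d _ => Finset.sum_congr rfl fun v _ => ?_
    simp only [Fin.consEquiv, Equiv.coe_fn_mk, Fin.prod_univ_succ, Fin.cons_zero, Fin.cons_succ,
      setBits_cons, Fin.val_zero, add_zero, Fin.val_succ, mul_assoc]
    congr 2
    refine Finset.prod_congr rfl fun i _ => ?_
    rw [Function.update_of_ne (by omega), Function.update_of_ne (by omega), add_assoc,
      add_comm 1 (i : ℕ)]

/-! ### Efficient channels -/

lemma setBits_of_le {b : ℕ} (x : ℕ → Bool) (a : ℕ) (u : Bits b) {i : ℕ} (hi : a + b ≤ i) :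
    setBits x a u i = x i := by
  rw [setBits, dif_neg (by omega)]

lemma load_congr_tail {N : ℕ} (ρ : Op N) {x x' y y' : ℕ → Bool} (hx : ∀ i, N ≤ i → x' i = x i)
    (hy : ∀ i, N ≤ i → y' i = y i) :
    load ρ x' y' = open Classical in
      if ∀ i, N ≤ i → x i = false ∧ y i = false then ρ (fun i => x' i) fun i => y' i else 0 := by
  classical
  refine if_congr (forall_congr' fun i => forall_congr' fun hi => ?_) rfl rfl
  rw [hx i hi, hy i hi]

lemma load_setBits_zero {n : ℕ} (ρ : Op n) (x y : ℕ → Bool) (u v : Bits n) :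
    load ρ (setBits x 0 u) (setBits y 0 v) = open Classical in
      if ∀ i, n ≤ i → x i = false ∧ y i = false then ρ u v else 0 := by
  have hset (x : ℕ → Bool) (u : Bits n) : (fun i : Fin n => setBits x 0 u i) = u := by
    funext i
    simp [setBits]
  rw [load_congr_tail ρ (fun i hi => setBits_of_le x 0 u (by omega))
    fun i hi => setBits_of_le y 0 v (by omega), hset, hset]

lemma load_setBits {n m : ℕ} (ρ : Op (n + m)) (x y : ℕ → Bool) (u v : Bits m) :
    load ρ (setBits x n u) (setBits y n v) = open Classical in
      if ∀ i, n + m ≤ i → x i = false ∧ y i = false then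
        ρ (Fin.append (fun i => x i) u) (Fin.append (fun i => y i) v) else 0 := by
  have hset (x : ℕ → Bool) (u : Bits m) :
      (fun i : Fin (n + m) => setBits x n u i) = Fin.append (fun i => x i) u := by
    funext i
    refine Fin.addCases (fun j => ?_) (fun j => ?_) i
    · rw [Fin.append_left, setBits, dif_neg (by simp), Fin.val_castAdd]
    · rw [Fin.append_right, setBits, dif_pos (by simp)]
      congr
      simp
  rw [load_congr_tail ρ (fun i => setBits_of_le x n u) fun i => setBits_of_le y n v, hset, hset]

/-- Kraus operators of the reset of a qubit to `|0⟩`, which implements the partial trace. -/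
def resetKraus : Fin 2 → Matrix Bool Bool ℂ :=
  ![Matrix.single false false 1, Matrix.single false true 1]

lemma sum_conjTranspose_resetKraus_mul_self : ∑ a, (resetKraus a)ᴴ * resetKraus a = 1 := by
  ext x y
  cases x <;> cases y <;> simp [resetKraus, Fin.sum_univ_two]

lemma krausKernel_resetKraus (x y u v : Bool) :
    krausKernel resetKraus x y u v = if x = false ∧ y = false ∧ u = v then 1 else 0 := by
  cases x <;> cases y <;> cases u <;> cases v <;>
    simp [krausKernel, resetKraus, Fin.sum_univ_two]

lemma prod_krausKernel_resetKraus {b : ℕ} (x y u v : Bits b) :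
    ∏ i, krausKernel resetKraus (x i) (y i) (u i) (v i) =
      if (∀ i, x i = false ∧ y i = false) ∧ u = v then 1 else 0 := by
  simp only [krausKernel_resetKraus, Finset.prod_ite_zero, Finset.prod_const_one,
    Finset.mem_univ, true_imp_iff, funext_iff, ← and_assoc, forall_and]

lemma run_ladder_resetKraus {n m : ℕ} (ρ : Op (n + m)) :
    run (fun _ : Fin 1 => oneQubitGate resetKraus sum_conjTranspose_resetKraus_mul_self)
      (ladder 0 n m) (load ρ) = load (traceOut ρ) := by
  classical
  funext x y
  have htail : (∀ i, n ≤ i → x i = false ∧ y i = false) ↔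
      (∀ i : Fin m, x (n + i) = false ∧ y (n + i) = false) ∧
        ∀ i, n + m ≤ i → x i = false ∧ y i = false := by
    refine ⟨fun h => ⟨fun i => h _ (by omega), fun i hi => h i (by omega)⟩, fun h i hi => ?_⟩
    rcases lt_or_ge i (n + m) with hlt | hge
    · simpa only [Nat.add_sub_cancel' hi] using h.1 ⟨i - n, by omega⟩
    · exact h.2 i hge
  simp only [run_ladder, prod_krausKernel_resetKraus (fun i => x (n + i)) fun i => y (n + i),
    load_setBits]
  simp only [load, traceOut, Matrix.of_apply, htail, ite_and]
  split_ifs <;> simp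

lemma efficient_traceOut (m κ : ℕ → ℕ) :
    Efficient (params m κ) (fun n => n + m n) (fun n => n) fun _ ρ => traceOut ρ :=
  ⟨1, _, _, polyTime_ladder_first_second 0, fun _ ρ => run_ladder_resetKraus ρ⟩

/-- The `n`-th tensor power of the channel with the given Kraus operators. -/
def tensorPower {k : ℕ} (K : Fin k → Matrix Bool Bool ℂ) {n : ℕ} (ρ : Op n) : Op n :=
  Matrix.of fun x y => ∑ u, ∑ v, (∏ i, krausKernel K (x i) (y i) (u i) (v i)) * ρ u v

lemma run_ladder_zero {k : ℕ} (K : Fin k → Matrix Bool Bool ℂ) (hK : ∑ a, (K a)ᴴ * K a = 1)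
    {n : ℕ} (ρ : Op n) :
    run (fun _ : Fin 1 => oneQubitGate K hK) (ladder 0 0 n) (load ρ) =
      load (tensorPower K ρ) := by
  classical
  funext x y
  simp only [run_ladder, load_setBits_zero, zero_add]
  simp only [load, tensorPower, Matrix.of_apply]
  split_ifs <;> simp

/-! ### Depolarizing noise -/

/-- Kraus operators of the depolarizing channel `Λ_p`. -/
noncomputable def depolKraus (p : ℝ) (s : Fin 4) : Matrix Bool Bool ℂ :=
  ((√(depolWeight p s) : ℝ) : ℂ) • pauli s

lemma depolWeight_nonneg {p : ℝ} (h0 : 0 ≤ p) (h1 : p ≤ 1) (s : Fin 4) :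
    0 ≤ depolWeight p s := by
  fin_cases s <;> simp [depolWeight] <;> linarith

lemma sum_depolWeight (p : ℝ) : ∑ s, depolWeight p s = 1 := by
  simp only [depolWeight, Fin.sum_univ_four, Matrix.cons_val]
  ring

lemma pauli_conjTranspose_mul_self (s : Fin 4) : (pauli s)ᴴ * pauli s = 1 := by
  ext x y
  fin_cases s <;> cases x <;> cases y <;> simp [pauli, Matrix.mul_apply]

lemma ofReal_sqrt_depolWeight_mul_self {p : ℝ} (h0 : 0 ≤ p) (h1 : p ≤ 1) (s : Fin 4) :
    ((√(depolWeight p s) : ℝ) : ℂ) * √(depolWeight p s) = depolWeight p s := by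
  rw [← Complex.ofReal_mul, Real.mul_self_sqrt (depolWeight_nonneg h0 h1 s)]

lemma sum_conjTranspose_depolKraus_mul_self {p : ℝ} (h0 : 0 ≤ p) (h1 : p ≤ 1) :
    ∑ s, (depolKraus p s)ᴴ * depolKraus p s = 1 := by
  simp only [depolKraus, Matrix.conjTranspose_smul, Matrix.smul_mul, Matrix.mul_smul, smul_smul,
    pauli_conjTranspose_mul_self, Complex.star_def, Complex.conj_ofReal,
    ofReal_sqrt_depolWeight_mul_self h0 h1]
  rw [← Finset.sum_smul, ← Complex.ofReal_sum, sum_depolWeight, Complex.ofReal_one, one_smul]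

lemma krausKernel_depolKraus {p : ℝ} (h0 : 0 ≤ p) (h1 : p ≤ 1) (x y u v : Bool) :
    krausKernel (depolKraus p) x y u v =
      ∑ s, ((depolWeight p s : ℝ) : ℂ) * (pauli s x u * star (pauli s y v)) := by
  refine Finset.sum_congr rfl fun s _ => ?_
  rw [← ofReal_sqrt_depolWeight_mul_self h0 h1, depolKraus, Matrix.smul_apply, Matrix.smul_apply,
    smul_eq_mul, smul_eq_mul, star_mul', Complex.star_def, Complex.conj_ofReal]
  ring

lemma tensorPower_depolKraus {p : ℝ} (h0 : 0 ≤ p) (h1 : p ≤ 1) {n : ℕ} (ρ : Op n) :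
    tensorPower (depolKraus p) ρ = localDepolarizing p n ρ := by
  ext x y
  simp only [tensorPower, krausKernel_depolKraus h0 h1, localDepolarizing, Matrix.sum_apply,
    Matrix.smul_apply, Matrix.mul_apply, Matrix.conjTranspose_apply, smul_eq_mul, pauliString,
    Matrix.of_apply, Finset.prod_univ_sum, Fintype.piFinset_univ, Finset.sum_mul,
    Finset.mul_sum]
  rw [Finset.sum_comm_cycle, Finset.sum_congr rfl fun _ _ => Finset.sum_comm]
  refine Finset.sum_congr rfl fun s _ => Finset.sum_congr rfl fun u _ =>
    Finset.sum_congr rfl fun v _ => ?_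
  rw [Finset.prod_mul_distrib, Finset.prod_mul_distrib, star_prod, Complex.ofReal_prod]
  ring

lemma run_ladder_depolKraus {p : ℝ} (h0 : 0 ≤ p) (h1 : p ≤ 1) {n : ℕ} (ρ : Op n) :
    run (fun _ : Fin 1 =>
        oneQubitGate (depolKraus p) (sum_conjTranspose_depolKraus_mul_self h0 h1))
      (ladder 0 0 n) (load ρ) = load (localDepolarizing p n ρ) := by
  rw [run_ladder_zero, tensorPower_depolKraus h0 h1]

lemma efficient_localDepolarizing {p : ℝ} (h0 : 0 ≤ p) (h1 : p ≤ 1) (m κ : ℕ → ℕ) :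
    Efficient (params m κ) (fun n => n) (fun n => n) fun n => localDepolarizing p n :=
  ⟨1, _, _, polyTime_ladder_first 0, fun _ ρ => run_ladder_depolKraus h0 h1 ρ⟩

lemma krausKernel_depolKraus_one (x y u v : Bool) :
    krausKernel (depolKraus 1) x y u v = if x = y ∧ u = v then 2⁻¹ else 0 := by
  rw [krausKernel_depolKraus zero_le_one le_rfl]
  cases x <;> cases y <;> cases u <;> cases v <;>
    simp [Fin.sum_univ_four, depolWeight, pauli] <;> norm_num

lemma localDepolarizing_one {n : ℕ} (ρ : Op n) :
    localDepolarizing 1 n ρ = ρ.trace • maxMixed n := by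
  have hprod (x y u v : Bits n) : ∏ i, krausKernel (depolKraus 1) (x i) (y i) (u i) (v i) =
      if x = y ∧ u = v then ((2 : ℂ) ^ n)⁻¹ else 0 := by
    simp only [krausKernel_depolKraus_one, Finset.prod_ite_zero, Finset.prod_const,
      Finset.card_univ, Fintype.card_fin, Finset.mem_univ, true_imp_iff, forall_and, funext_iff,
      inv_pow]
  ext x y
  simp only [← tensorPower_depolKraus zero_le_one le_rfl, tensorPower, hprod, Matrix.of_apply,
    maxMixed, Matrix.smul_apply, Matrix.one_apply, smul_eq_mul, Matrix.trace, Matrix.diag_apply,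
    Finset.sum_mul]
  refine Finset.sum_congr rfl fun u _ => ?_
  by_cases h : x = y <;> simp [h, mul_comm]

lemma load_one_eq_load_basisState (n : ℕ) :
    load (1 : Op 0) = load (basisState (fun _ => false : Bits n)) := by
  classical
  funext x y
  have htail : (∀ i, 0 ≤ i → x i = false ∧ y i = false) ↔
      (∀ i, n ≤ i → x i = false ∧ y i = false) ∧
        (fun _ => false) = (fun i : Fin n => x i) ∧ (fun _ => false) = fun i : Fin n => y i := by
    simp only [funext_iff, ← forall_and]
    refine ⟨fun h => ⟨fun i _ => h i i.zero_le, fun i => ?_⟩, fun h i _ => ?_⟩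
    · exact ⟨(h i i.1.zero_le).1.symm, (h i i.1.zero_le).2.symm⟩
    · rcases lt_or_ge i n with hi | hi
      · exact ⟨(h.2 ⟨i, hi⟩).1.symm, (h.2 ⟨i, hi⟩).2.symm⟩
      · exact h.1 i hi
  simp only [load, basisState, Matrix.single_apply, htail, ite_and]
  split_ifs <;> rfl

lemma load_zero_dim (ρ : Op 0) : load ρ = ρ default default • load (1 : Op 0) := by
  rw [← load_smul]
  congr 1
  ext a b
  rw [Subsingleton.elim a default, Subsingleton.elim b default]
  simp

lemma efficient_maxMixed (pp : ℕ → List ℕ) {b : List ℕ → ℕ}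
    (hb : Nonempty (Turing.TM2ComputableInPolyTime encodeParams encodeCircuit
      fun l => ladder (0 : Fin 1) 0 (b l))) :
    Efficient pp (fun _ => 0) (fun n => b (pp n))
      fun n ρ => ρ default default • maxMixed (b (pp n)) := by
  refine ⟨1, fun _ => oneQubitGate _ (sum_conjTranspose_depolKraus_mul_self zero_le_one le_rfl), _,
    hb, fun n ρ => ?_⟩
  rw [load_zero_dim, run_smul, load_one_eq_load_basisState (b (pp n)),
    run_ladder_depolKraus zero_le_one le_rfl, localDepolarizing_one, basisState,
    Matrix.trace_single_eq_same, one_smul]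
  exact (load_smul _ _).symm

lemma maxMixed_eq_smul_sum_basisState (n : ℕ) :
    maxMixed n = ((2 : ℂ) ^ n)⁻¹ • ∑ k : Bits n, basisState k := by
  simp only [maxMixed, basisState, Matrix.sum_single_one]

lemma pauliString_mul_conjTranspose_self {n : ℕ} (s : Fin n → Fin 4) :
    pauliString s * (pauliString s)ᴴ = 1 := by
  ext x y
  have hfactor (i : Fin n) : ∑ u, pauli (s i) (x i) u * star (pauli (s i) (y i) u) =
      if x i = y i then 1 else 0 := by
    rw [← Matrix.one_apply, ← mul_eq_one_comm.1 (pauli_conjTranspose_mul_self (s i))]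
    rfl
  simp only [Matrix.mul_apply, Matrix.conjTranspose_apply, pauliString, Matrix.of_apply,
    star_prod, ← Finset.prod_mul_distrib]
  rw [← Fintype.prod_sum fun i u => pauli (s i) (x i) u * star (pauli (s i) (y i) u)]
  simp only [hfactor, Finset.prod_ite_zero, Finset.prod_const_one, Finset.mem_univ, true_imp_iff,
    funext_iff, Matrix.one_apply]

lemma sum_prod_depolWeight (p : ℝ) (n : ℕ) :
    ∑ s : Fin n → Fin 4, ∏ i, depolWeight p (s i) = 1 := by
  rw [← Fintype.prod_sum fun _ s => depolWeight p s]
  simp [sum_depolWeight]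

lemma localDepolarizing_maxMixed (p : ℝ) (n : ℕ) :
    localDepolarizing p n (maxMixed n) = maxMixed n := by
  simp only [localDepolarizing, maxMixed, Matrix.mul_smul, Matrix.smul_mul, mul_one,
    pauliString_mul_conjTranspose_self]
  rw [← Finset.sum_smul, ← Complex.ofReal_sum, sum_prod_depolWeight, Complex.ofReal_one, one_smul]

/-! ### The first moment of Haar random states -/

section Sphere

variable {E : Type*} [NormedAddCommGroup E] [NormedSpace ℝ E]

/-- The homeomorphism of the unit sphere induced by a linear isometry. -/
def sphereHomeomorph (f : E ≃ₗᵢ[ℝ] E) :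
    Metric.sphere (0 : E) 1 ≃ₜ Metric.sphere (0 : E) 1 :=
  f.toHomeomorph.subtype fun v => by simp

open scoped Pointwise in
lemma measurePreserving_sphereHomeomorph [MeasurableSpace E] [BorelSpace E] {μ : Measure E}
    {f : E ≃ₗᵢ[ℝ] E} (hf : MeasurePreserving f μ μ) :
    MeasurePreserving (sphereHomeomorph f) μ.toSphere μ.toSphere := by
  have hmeas := (sphereHomeomorph f).continuous.measurable
  refine ⟨hmeas, Measure.ext fun s hs => ?_⟩
  rw [Measure.map_apply hmeas hs, Measure.toSphere_apply' _ (hmeas hs),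
    Measure.toSphere_apply' _ hs]
  congr 1
  have hcone : Set.Ioo (0 : ℝ) 1 • ((↑) '' (sphereHomeomorph f ⁻¹' s) : Set E) =
      f ⁻¹' (Set.Ioo (0 : ℝ) 1 • ((↑) '' s)) := by
    ext v
    simp only [Set.mem_smul, Set.mem_image, Set.mem_preimage]
    constructor
    · rintro ⟨c, hc, _, ⟨w, hw, rfl⟩, rfl⟩
      exact ⟨c, hc, _, ⟨_, hw, rfl⟩, (map_smul f c w.1).symm⟩
    · rintro ⟨c, hc, _, ⟨w, hw, rfl⟩, h⟩
      refine ⟨c, hc, _, ⟨(sphereHomeomorph f).symm w, by simpa using hw, rfl⟩, f.injective ?_⟩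
      rw [← h, map_smul]
      exact congrArg (c • ·) (f.apply_symm_apply w.1)
  rw [hcone]
  exact hf.measure_preimage_emb f.toHomeomorph.measurableEmbedding _

end Sphere

section Haar

variable {N : ℕ}

instance isProbabilityMeasure_haarState : IsProbabilityMeasure (haarState N) := by
  refine ⟨?_⟩
  rw [haarState, Measure.smul_apply, smul_eq_mul]
  exact ENNReal.inv_mul_cancel (Measure.measure_univ_ne_zero.2 (Measure.toSphere_ne_zero _))
    (measure_ne_top _ _)

lemma integral_haarState_comp
    (f : EuclideanSpace ℂ (Bits N) ≃ₗᵢ[ℝ] EuclideanSpace ℂ (Bits N))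
    (φ : EuclideanSpace ℂ (Bits N) → ℂ) :
    ∫ v, φ (f v.1) ∂(haarState N) = ∫ v, φ v.1 ∂(haarState N) := by
  rw [haarState, integral_smul_measure, integral_smul_measure]
  congr 1
  exact (measurePreserving_sphereHomeomorph f.measurePreserving).integral_comp
    (sphereHomeomorph f).measurableEmbedding fun v => φ v.1

lemma integrable_mul_star_haarState (x y : Bits N) :
    Integrable (fun v => v.1 x * star (v.1 y)) (haarState N) :=
  Continuous.integrable_of_hasCompactSupport (by fun_prop) (HasCompactSupport.of_compactSpace _)

lemma sum_mul_star_eq_one (v : Metric.sphere (0 : EuclideanSpace ℂ (Bits N)) 1) :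
    ∑ x, v.1 x * star (v.1 x) = 1 := by
  have hnorm : ‖v.1‖ = 1 := by simp
  rw [EuclideanSpace.norm_eq, Real.sqrt_eq_one] at hnorm
  simp only [Complex.star_def, Complex.mul_conj, Complex.normSq_eq_norm_sq]
  exact_mod_cast hnorm

lemma integral_mul_star_self_haarState (x : Bits N) :
    ∫ v, v.1 x * star (v.1 x) ∂(haarState N) = ((2 : ℂ) ^ N)⁻¹ := by
  classical
  have hsame (y : Bits N) : ∫ v, v.1 y * star (v.1 y) ∂(haarState N) =
      ∫ v, v.1 x * star (v.1 x) ∂(haarState N) := by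
    rw [← integral_haarState_comp
      (LinearIsometryEquiv.piLpCongrLeft 2 ℝ ℂ (Equiv.swap x y)) fun v => v y * star (v y)]
    simp [LinearIsometryEquiv.piLpCongrLeft_apply]
  have hsum : ∑ y : Bits N, ∫ v, v.1 y * star (v.1 y) ∂(haarState N) = 1 := by
    rw [← integral_finsetSum _ fun y _ => integrable_mul_star_haarState y y]
    simp only [sum_mul_star_eq_one, integral_const, probReal_univ, one_smul]
  rw [Finset.sum_congr rfl fun y _ => hsame y, Finset.sum_const, nsmul_eq_mul] at hsum
  refine eq_inv_of_mul_eq_one_right ?_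
  simpa using hsum

/-- Flipping the sign of the coordinate `x` preserves the measure and negates the integrand. -/
lemma integral_mul_star_haarState_of_ne {x y : Bits N} (hxy : x ≠ y) :
    ∫ v, v.1 x * star (v.1 y) ∂(haarState N) = 0 := by
  have h := integral_haarState_comp
    (LinearIsometryEquiv.piLpCongrRight 2 fun i : Bits N =>
      if i = x then LinearIsometryEquiv.neg ℝ else .refl ℝ ℂ) fun v => v x * star (v y)
  simp only [LinearIsometryEquiv.piLpCongrRight_apply, if_true, hxy.symm, if_false,
    LinearIsometryEquiv.coe_neg, LinearIsometryEquiv.coe_refl, id_eq, neg_mul,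
    integral_neg] at h
  exact CharZero.neg_eq_self_iff.1 h

lemma integral_mul_star_haarState (x y : Bits N) :
    ∫ v, v.1 x * star (v.1 y) ∂(haarState N) = maxMixed N x y := by
  rw [maxMixed, Matrix.smul_apply, Matrix.one_apply]
  split_ifs with hxy
  · rw [hxy, integral_mul_star_self_haarState, smul_eq_mul, mul_one]
  · rw [integral_mul_star_haarState_of_ne hxy, smul_zero]

lemma linearMap_apply_eq_sum_single (L : Op N →ₗ[ℂ] ℂ) (X : Op N) :
    L X = ∑ x, ∑ y, X x y * L (Matrix.single x y 1) := by
  conv_lhs => rw [Matrix.matrix_eq_sum_single X]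
  simp only [map_sum]
  refine Finset.sum_congr rfl fun x _ => Finset.sum_congr rfl fun y _ => ?_
  rw [← smul_eq_mul, ← map_smul, Matrix.smul_single, smul_eq_mul, mul_one]

lemma linearMap_ketBra_eq_sum (L : Op N →ₗ[ℂ] ℂ) (φ : Bits N → ℂ) :
    L (ketBra φ) = ∑ x, ∑ y, φ x * star (φ y) * L (Matrix.single x y 1) :=
  linearMap_apply_eq_sum_single L (ketBra φ)

lemma integrable_linearMap_ketBra_haarState (L : Op N →ₗ[ℂ] ℂ) :
    Integrable (fun v => L (ketBra fun x => v.1 x)) (haarState N) := by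
  simp only [linearMap_ketBra_eq_sum]
  exact integrable_finsetSum _ fun x _ => integrable_finsetSum _ fun y _ =>
    (integrable_mul_star_haarState x y).mul_const _

lemma integral_linearMap_ketBra_haarState (L : Op N →ₗ[ℂ] ℂ) :
    ∫ v, L (ketBra fun x => v.1 x) ∂(haarState N) = L (maxMixed N) := by
  have hint (x y : Bits N) := (integrable_mul_star_haarState x y).mul_const
    (L (Matrix.single x y 1))
  rw [linearMap_apply_eq_sum_single L (maxMixed N)]
  simp only [linearMap_ketBra_eq_sum]
  rw [integral_finsetSum _ fun x _ => integrable_finsetSum _ fun y _ => hint x y]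
  refine Finset.sum_congr rfl fun x _ => ?_
  rw [integral_finsetSum _ fun y _ => hint x y]
  refine Finset.sum_congr rfl fun y _ => ?_
  rw [integral_mul_const, integral_mul_star_haarState]

lemma integral_acceptProb_haarState (A : Op N →ₗ[ℂ] Op 1) :
    ∫ v, acceptProb (A (ketBra fun x => v.1 x)) ∂(haarState N) = acceptProb (A (maxMixed N)) := by
  let L := Matrix.entryLinearMap ℂ ℂ (fun _ => true) (fun _ => true) ∘ₗ A
  have hre := integral_re (𝕜 := ℂ) (integrable_linearMap_ketBra_haarState L)
  rw [integral_linearMap_ketBra_haarState L] at hre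
  exact hre

end Haar

/-! ### Testing with a projection -/

section ProjTrace

variable {N : ℕ}

/-- The linear functional `X ↦ tr (Π X)`, with `Π` the orthogonal projection onto `W`: the
probability that the test `Π` accepts the state `X`. -/
noncomputable def projTrace (W : Submodule ℂ (EuclideanSpace ℂ (Bits N))) : Op N →ₗ[ℂ] ℂ :=
  LinearMap.trace ℂ _ ∘ₗ LinearMap.mulLeft ℂ W.starProjection.toLinearMap ∘ₗ
    (Matrix.toEuclideanLin (𝕜 := ℂ)).toLinearMap

variable (W : Submodule ℂ (EuclideanSpace ℂ (Bits N)))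

lemma projTrace_apply (X : Op N) : projTrace W X =
    LinearMap.trace ℂ _ (W.starProjection.toLinearMap ∘ₗ Matrix.toEuclideanLin X) := rfl

lemma projTrace_eq_sum_inner {ι : Type*} [Fintype ι] (X : Op N)
    (b : OrthonormalBasis ι ℂ (EuclideanSpace ℂ (Bits N))) :
    projTrace W X = ∑ i, inner ℂ (b i) (W.starProjection (Matrix.toEuclideanLin X (b i))) :=
  LinearMap.trace_eq_sum_inner _ b

lemma projTrace_one : projTrace W 1 = Module.finrank ℂ W := by
  have hproj : LinearMap.IsProj W W.starProjection.toLinearMap :=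
    ⟨W.starProjection_apply_mem, fun x hx => W.starProjection_eq_self_iff.2 hx⟩
  rw [projTrace_apply, Matrix.toLpLin_one, LinearMap.comp_id, hproj.trace]

lemma re_projTrace_maxMixed :
    (projTrace W (maxMixed N)).re = ((2 : ℝ) ^ N)⁻¹ * Module.finrank ℂ W := by
  have hcast : ((2 : ℂ) ^ N)⁻¹ = (((2 : ℝ) ^ N)⁻¹ : ℝ) := by push_cast; rfl
  rw [maxMixed, map_smul, projTrace_one, smul_eq_mul, hcast, Complex.re_ofReal_mul,
    Complex.natCast_re]

lemma toEuclideanLin_ketBra (φ : Bits N → ℂ) (u : EuclideanSpace ℂ (Bits N)) :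
    Matrix.toEuclideanLin (ketBra φ) u = inner ℂ (WithLp.toLp 2 φ) u • WithLp.toLp 2 φ := by
  ext x
  rw [ketBra, Matrix.ofLp_toLpLin, Matrix.toLin'_apply, Matrix.vecMulVec_mulVec,
    EuclideanSpace.inner_eq_star_dotProduct, dotProduct_comm]
  exact mul_comm _ _

lemma projTrace_ketBra (φ : Bits N → ℂ) :
    projTrace W (ketBra φ) = inner ℂ (WithLp.toLp 2 φ) (W.starProjection (WithLp.toLp 2 φ)) := by
  let b := EuclideanSpace.basisFun (Bits N) ℂ
  rw [projTrace_eq_sum_inner W _ b, ← b.sum_inner_mul_inner]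
  refine Finset.sum_congr rfl fun i _ => ?_
  rw [toEuclideanLin_ketBra, map_smul, inner_smul_right]

lemma re_projTrace_ketBra_nonneg (φ : Bits N → ℂ) : 0 ≤ (projTrace W (ketBra φ)).re := by
  rw [projTrace_ketBra, ← W.inner_starProjection_left_eq_right]
  exact W.re_inner_starProjection_nonneg _

lemma re_projTrace_ketBra_of_mem {φ : Bits N → ℂ} (hφ : WithLp.toLp 2 φ ∈ W) :
    (projTrace W (ketBra φ)).re = ∑ x, ‖φ x‖ ^ 2 := by
  rw [projTrace_ketBra, W.starProjection_eq_self_iff.2 hφ]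
  exact (inner_self_eq_norm_sq (𝕜 := ℂ) _).trans (EuclideanSpace.norm_sq_eq _)

lemma norm_toEuclideanLin_eigenvectorBasis_sq (A : Op N)
    (hA : (Aᴴ * A).IsHermitian) (i : Bits N) :
    ‖Matrix.toEuclideanLin A (hA.eigenvectorBasis i)‖ ^ 2 = hA.eigenvalues i := by
  set u := hA.eigenvectorBasis i with hu
  have heigen : LinearMap.adjoint (Matrix.toEuclideanLin A) (Matrix.toEuclideanLin A u) =
      (hA.eigenvalues i : ℂ) • u := by
    rw [← Matrix.toEuclideanLin_conjTranspose_eq_adjoint]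
    ext x
    have h := congrFun (hA.mulVec_eigenvectorBasis i) x
    simpa [hu, Matrix.mulVec_mulVec] using h
  have hinner : inner ℂ (Matrix.toEuclideanLin A u) (Matrix.toEuclideanLin A u) =
      (hA.eigenvalues i : ℂ) := by
    rw [← LinearMap.adjoint_inner_right, heigen, inner_smul_right, inner_self_eq_norm_sq_to_K,
      hu, hA.eigenvectorBasis.norm_eq_one]
    simp
  rw [inner_self_eq_norm_sq_to_K] at hinner
  exact Complex.ofReal_injective ((Complex.ofReal_pow _ _).trans hinner)

lemma re_projTrace_le_traceNorm (A : Op N) : (projTrace W A).re ≤ traceNorm A := by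
  have hA := Matrix.isHermitian_conjTranspose_mul_self A
  rw [projTrace_eq_sum_inner W A hA.eigenvectorBasis, Complex.re_sum, traceNorm]
  refine Finset.sum_le_sum fun i _ => ?_
  set u := hA.eigenvectorBasis i
  have hu : ‖u‖ = 1 := hA.eigenvectorBasis.norm_eq_one i
  calc (inner ℂ u (W.starProjection (Matrix.toEuclideanLin A u))).re
      ≤ ‖u‖ * ‖W.starProjection (Matrix.toEuclideanLin A u)‖ := re_inner_le_norm (𝕜 := ℂ) _ _
    _ = ‖W.starProjection (Matrix.toEuclideanLin A u)‖ := by rw [hu, one_mul]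
    _ ≤ ‖Matrix.toEuclideanLin A u‖ := W.norm_starProjection_apply_le _
    _ = √(hA.eigenvalues i) := by
      rw [← norm_toEuclideanLin_eigenvectorBasis_sq A hA, Real.sqrt_sq (norm_nonneg _)]

end ProjTrace

/-! ### Entropy and typical strings -/

section Entropy

lemma sum_prod_mul_apply {ι : Type*} [Fintype ι] {w : ι → ℝ} (hw : ∑ a, w a = 1) (f : ι → ℝ)
    {n : ℕ} (i : Fin n) :
    ∑ s : Fin n → ι, (∏ j, w (s j)) * f (s i) = ∑ a, w a * f a := by
  classical
  have hsplit (s : Fin n → ι) : (∏ j, w (s j)) * f (s i) =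
      ∏ j, w (s j) * if j = i then f (s j) else 1 := by
    rw [Finset.prod_mul_distrib, Finset.prod_ite_eq' Finset.univ i, if_pos (Finset.mem_univ i)]
  simp only [hsplit]
  rw [← Fintype.prod_sum fun j a => w a * if j = i then f a else 1, Finset.prod_eq_single i]
  · simp only [if_true]
  · intro j _ hj
    simp only [hj, if_false, mul_one, hw]
  · exact fun hi => absurd (Finset.mem_univ i) hi

lemma negMulLog_prod {ι : Type*} [Fintype ι] (x : ι → ℝ) :
    Real.negMulLog (∏ i, x i) = ∑ i, (∏ j, x j) * -Real.log (x i) := by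
  rw [← Finset.mul_sum, Real.negMulLog, Finset.sum_neg_distrib, mul_neg, neg_mul]
  by_cases hzero : ∏ i, x i = 0
  · rw [hzero, zero_mul, zero_mul]
  · rw [Real.log_prod fun i hi => Finset.prod_ne_zero_iff.1 hzero i hi]

lemma sum_negMulLog_prod {ι : Type*} [Fintype ι] {w : ι → ℝ} (hw : ∑ a, w a = 1) (n : ℕ) :
    ∑ s : Fin n → ι, Real.negMulLog (∏ i, w (s i)) = n * ∑ a, Real.negMulLog (w a) := by
  simp only [negMulLog_prod]
  rw [Finset.sum_comm,
    Finset.sum_congr rfl fun i _ => sum_prod_mul_apply hw (fun a => -Real.log (w a)) i]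
  simp only [Real.negMulLog, neg_mul, mul_neg, Finset.sum_const, Finset.card_univ,
    Fintype.card_fin, nsmul_eq_mul]

/-- Markov's inequality for the surprisal `-log₂ (q s)`, whose mean is the entropy. -/
lemma inv_le_sum_typical {ι : Type*} [Fintype ι] {q : ι → ℝ} (hq0 : ∀ s, 0 ≤ q s)
    (hq1 : ∑ s, q s = 1) {t : ℝ} (ht : 0 < t)
    (hent : ∑ s, Real.negMulLog (q s) ≤ (t - 1) * Real.log 2) :
    t⁻¹ ≤ ∑ s with (2 : ℝ) ^ (-t) ≤ q s, q s := by
  have hlog : 0 < Real.log 2 := Real.log_pos one_lt_two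
  have hle (s : ι) : q s ≤ 1 :=
    hq1 ▸ Finset.single_le_sum (fun s _ => hq0 s) (Finset.mem_univ s)
  have hsurprisal (s : ι) (hs : q s < (2 : ℝ) ^ (-t)) :
      q s * (t * Real.log 2) ≤ Real.negMulLog (q s) := by
    rcases (hq0 s).eq_or_lt with hzero | hpos
    · simp [← hzero]
    · have := Real.log_le_log hpos hs.le
      rw [Real.log_rpow two_pos] at this
      rw [Real.negMulLog, neg_mul, ← mul_neg]
      exact mul_le_mul_of_nonneg_left (by linarith) (hq0 s)
  have hmarkov : (∑ s with ¬(2 : ℝ) ^ (-t) ≤ q s, q s) * t ≤ t - 1 := by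
    refine le_of_mul_le_mul_right (le_trans ?_ hent) hlog
    rw [mul_assoc, Finset.sum_mul]
    exact (Finset.sum_le_sum fun s hs => hsurprisal s (not_le.1 (Finset.mem_filter.1 hs).2)).trans
      (Finset.sum_le_univ_sum_of_nonneg fun s => Real.negMulLog_nonneg (hq0 s) (hle s))
  have hsplit := Finset.sum_filter_add_sum_filter_not Finset.univ
    (fun s => (2 : ℝ) ^ (-t) ≤ q s) q
  rw [hq1, ← eq_sub_iff_add_eq] at hsplit
  rw [hsplit, inv_le_iff_one_le_mul₀ ht, sub_mul, one_mul]
  linarith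

end Entropy

/-! ### Statistical distance of the noisy states -/

section Far

variable {n m κ : ℕ}

lemma traceOut_ketBra (φ : Bits (n + m) → ℂ) :
    traceOut (ketBra φ) = ∑ z : Bits m, ketBra fun a : Bits n => φ (Fin.append a z) := by
  ext a b
  simp only [traceOut, ketBra, Matrix.of_apply, Matrix.sum_apply, Matrix.vecMulVec_apply,
    Pi.star_apply]

lemma sum_norm_sq_append (φ : Bits (n + m) → ℂ) :
    ∑ z : Bits m, ∑ a : Bits n, ‖φ (Fin.append a z)‖ ^ 2 = ∑ x, ‖φ x‖ ^ 2 := by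
  rw [Finset.sum_comm, ← (Fin.appendEquiv n m).sum_comp, Fintype.sum_prod_type]
  rfl

lemma mul_ketBra_mul_conjTranspose (P : Op n) (φ : Bits n → ℂ) :
    P * ketBra φ * Pᴴ = ketBra (P *ᵥ φ) := by
  rw [ketBra, Matrix.mul_vecMulVec, Matrix.vecMulVec_mul, ← Matrix.star_mulVec, ketBra]

lemma ofReal_sum_norm_sq (φ : Bits n → ℂ) : ((∑ x, ‖φ x‖ ^ 2 : ℝ) : ℂ) = star φ ⬝ᵥ φ := by
  simp only [dotProduct, Pi.star_apply, Complex.star_def, Complex.conj_mul', Complex.ofReal_sum,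
    Complex.ofReal_pow]

lemma sum_norm_sq_mulVec {P : Op n} (hP : Pᴴ * P = 1) (φ : Bits n → ℂ) :
    ∑ x, ‖(P *ᵥ φ) x‖ ^ 2 = ∑ x, ‖φ x‖ ^ 2 := by
  apply Complex.ofReal_injective
  rw [ofReal_sum_norm_sq, ofReal_sum_norm_sq, Matrix.star_mulVec, ← Matrix.dotProduct_mulVec,
    Matrix.mulVec_mulVec, hP, Matrix.one_mulVec]

lemma sum_sub_card_div_le_traceNorm {ι : Type*} [Fintype ι] {w : ι → ℝ} (hw : ∀ i, 0 ≤ w i)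
    (φ : ι → Bits n → ℂ) (S : Finset ι) :
    ∑ i ∈ S, w i * ∑ x, ‖φ i x‖ ^ 2 - S.card / 2 ^ n ≤
      traceNorm (∑ i, (w i : ℂ) • ketBra (φ i) - maxMixed n) := by
  classical
  let v (i : ι) : EuclideanSpace ℂ (Bits n) := WithLp.toLp 2 (φ i)
  let W := Submodule.span ℂ (S.image v : Set (EuclideanSpace ℂ (Bits n)))
  have hmem (i : ι) (hi : i ∈ S) : v i ∈ W :=
    Submodule.subset_span (Finset.mem_coe.2 (Finset.mem_image_of_mem v hi))
  have hdim : Module.finrank ℂ W ≤ S.card :=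
    (finrank_span_finset_le_card _).trans Finset.card_image_le
  have hterm (i : ι) : (projTrace W ((w i : ℂ) • ketBra (φ i))).re =
      w i * (projTrace W (ketBra (φ i))).re := by
    rw [map_smul, smul_eq_mul, Complex.re_ofReal_mul]
  have haccept : ∑ i ∈ S, w i * ∑ x, ‖φ i x‖ ^ 2 ≤
      (projTrace W (∑ i, (w i : ℂ) • ketBra (φ i))).re := by
    simp only [map_sum, Complex.re_sum, hterm]
    refine (Finset.sum_le_sum fun i hi => ?_).trans (Finset.sum_le_univ_sum_of_nonneg fun i =>
      mul_nonneg (hw i) (re_projTrace_ketBra_nonneg W _))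
    rw [re_projTrace_ketBra_of_mem W (hmem i hi)]
  have hmixed : (projTrace W (maxMixed n)).re ≤ S.card / 2 ^ n := by
    rw [re_projTrace_maxMixed, inv_mul_eq_div]
    gcongr
  refine le_trans ?_ (re_projTrace_le_traceNorm W _)
  rw [map_sub, Complex.sub_re]
  exact sub_le_sub haccept hmixed

lemma localDepolarizing_uniform_traceOut_ketBra (p : ℝ) (ψ : Bits κ → (Bits (n + m) → ℂ)) :
    localDepolarizing p n (((2 : ℂ) ^ κ)⁻¹ • ∑ k, traceOut (ketBra (ψ k))) =
      ∑ i : (Fin n → Fin 4) × Bits κ × Bits m,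
        (((∏ j, depolWeight p (i.1 j)) * ((2 : ℝ) ^ κ)⁻¹ : ℝ) : ℂ) •
          ketBra (pauliString i.1 *ᵥ fun a => ψ i.2.1 (Fin.append a i.2.2)) := by
  simp only [localDepolarizing, traceOut_ketBra, Matrix.mul_smul, Matrix.smul_mul, Matrix.mul_sum,
    Matrix.sum_mul, mul_ketBra_mul_conjTranspose, Fintype.sum_prod_type, Finset.smul_sum,
    smul_smul, Complex.ofReal_mul, Complex.ofReal_inv, Complex.ofReal_pow, Complex.ofReal_ofNat]

lemma sum_sub_card_div_le_traceNorm_localDepolarizing {p : ℝ} (h0 : 0 ≤ p) (h1 : p ≤ 1)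
    {ψ : Bits κ → (Bits (n + m) → ℂ)} (hψ : ∀ k, ∑ x, ‖ψ k x‖ ^ 2 = 1)
    (T : Finset (Fin n → Fin 4)) :
    ∑ s ∈ T, ∏ j, depolWeight p (s j) - T.card * 2 ^ κ * 2 ^ m / 2 ^ n ≤
      traceNorm (localDepolarizing p n (((2 : ℂ) ^ κ)⁻¹ • ∑ k, traceOut (ketBra (ψ k))) -
        maxMixed n) := by
  have hsum (s : Fin n → Fin 4) (k : Bits κ) :
      ∑ z : Bits m, ∑ x, ‖(pauliString s *ᵥ fun a => ψ k (Fin.append a z)) x‖ ^ 2 = 1 := by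
    have hP := mul_eq_one_comm.1 (pauliString_mul_conjTranspose_self s)
    simp only [sum_norm_sq_mulVec hP, sum_norm_sq_append, hψ]
  rw [localDepolarizing_uniform_traceOut_ketBra]
  refine le_trans (le_of_eq ?_) (sum_sub_card_div_le_traceNorm (fun i => mul_nonneg
    (Finset.prod_nonneg fun j _ => depolWeight_nonneg h0 h1 (i.1 j)) (by positivity)) _
      (T ×ˢ (Finset.univ ×ˢ Finset.univ)))
  congr 1
  · simp only [Finset.sum_product, ← Finset.mul_sum, hsum]
    simp
  · simp [Finset.card_product, mul_assoc]

lemma sum_negMulLog_prod_depolWeight (p : ℝ) (n : ℕ) :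
    ∑ s : Fin n → Fin 4, Real.negMulLog (∏ j, depolWeight p (s j)) =
      n * shannonEntropy (depolWeight p) * Real.log 2 := by
  rw [sum_negMulLog_prod (sum_depolWeight p), shannonEntropy, ← Finset.sum_div, mul_assoc,
    div_mul_cancel₀ _ (Real.log_pos one_lt_two).ne']

lemma shannonEntropy_nonneg {ι : Type*} [Fintype ι] {q : ι → ℝ} (hq0 : ∀ i, 0 ≤ q i)
    (hq1 : ∑ i, q i = 1) : 0 ≤ shannonEntropy q :=
  Finset.sum_nonneg fun i _ => div_nonneg (Real.negMulLog_nonneg (hq0 i)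
    (hq1 ▸ Finset.single_le_sum (fun i _ => hq0 i) (Finset.mem_univ i)))
    (Real.log_pos one_lt_two).le

lemma inv_two_mul_le_traceNorm_localDepolarizing {p : ℝ} (h0 : 0 ≤ p) (h1 : p ≤ 1)
    {ψ : Bits κ → (Bits (n + m) → ℂ)} (hψ : ∀ k, ∑ x, ‖ψ k x‖ ^ 2 = 1)
    (hent : κ + m + n * shannonEntropy (depolWeight p) ≤ n - 2) :
    (2 * (n : ℝ))⁻¹ ≤ traceNorm (localDepolarizing p n
      (((2 : ℂ) ^ κ)⁻¹ • ∑ k, traceOut (ketBra (ψ k))) - maxMixed n) := by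
  set w : (Fin n → Fin 4) → ℝ := fun s => ∏ j, depolWeight p (s j)
  set t : ℝ := n - κ - m - 1 with ht
  set T : Finset (Fin n → Fin 4) := {s | (2 : ℝ) ^ (-t) ≤ w s}
  have hnonneg : 0 ≤ n * shannonEntropy (depolWeight p) :=
    mul_nonneg n.cast_nonneg (shannonEntropy_nonneg (depolWeight_nonneg h0 h1) (sum_depolWeight p))
  have htpos : 0 < t := by linarith
  have htn : t ≤ n := by
    have : (0 : ℝ) ≤ κ := κ.cast_nonneg
    have : (0 : ℝ) ≤ m := m.cast_nonneg
    linarith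
  have htypical : t⁻¹ ≤ ∑ s ∈ T, w s := by
    refine inv_le_sum_typical (fun s => Finset.prod_nonneg fun j _ => depolWeight_nonneg h0 h1 _)
      (sum_prod_depolWeight p n) htpos ?_
    rw [sum_negMulLog_prod_depolWeight]
    gcongr
    linarith
  have hcard : T.card * (2 : ℝ) ^ (-t) ≤ ∑ s ∈ T, w s := by
    rw [← nsmul_eq_mul]
    exact Finset.card_nsmul_le_sum _ _ _ fun s hs => (Finset.mem_filter.1 hs).2
  have hdim : T.card * 2 ^ κ * 2 ^ m / 2 ^ n = T.card * (2 : ℝ) ^ (-t) / 2 := by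
    rw [show -t = κ + m + 1 - n by rw [ht]; ring, Real.rpow_sub two_pos, Real.rpow_add two_pos,
      Real.rpow_add two_pos, Real.rpow_one, Real.rpow_natCast, Real.rpow_natCast,
      Real.rpow_natCast]
    ring
  refine le_trans ?_ (sum_sub_card_div_le_traceNorm_localDepolarizing h0 h1 hψ T)
  have hinv : (n : ℝ)⁻¹ ≤ t⁻¹ := inv_anti₀ htpos htn
  rw [hdim, mul_inv]
  linarith

end Far

/-! ### Robustness of the EFI pair -/

section Robustness

/-- Transport of operators along an equality of the numbers of qubits. It identifies a single copy
of a state on `N` qubits, which lives on `1 * N` qubits, with the state itself. -/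
def castOp {N M : ℕ} (h : N = M) (ρ : Op N) : Op M :=
  Matrix.of fun a b => ρ (fun i => a (Fin.cast h i)) fun i => b (Fin.cast h i)

lemma load_castOp {N M : ℕ} (h : N = M) (ρ : Op N) : load (castOp h ρ) = load ρ := by
  subst h
  rfl

lemma Efficient.castOp_left {pp : ℕ → List ℕ} {N N' M : ℕ → ℕ} {Φ : ∀ n, Op (N n) → Op (M n)}
    (hΦ : Efficient pp N M Φ) (h : ∀ n, N' n = N n) :
    Efficient pp N' M fun n ρ => Φ n (castOp (h n) ρ) := by
  obtain ⟨r, lib, C, hC, hrun⟩ := hΦ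
  exact ⟨r, lib, C, hC, fun n ρ => by rw [← hrun, load_castOp]⟩

lemma castOp_ketBra_copies_one {N : ℕ} (φ : Bits N → ℂ) :
    castOp (one_mul N) (ketBra (copies 1 φ)) = ketBra φ := by
  have hcopies (a : Bits N) : copies 1 φ (fun i => a (Fin.cast (one_mul N) i)) = φ a := by
    rw [copies, Fin.prod_univ_one]
    congr 1
  ext a b
  simp only [castOp, ketBra, Matrix.of_apply, Matrix.vecMulVec_apply, Pi.star_apply, hcopies]

lemma acceptProb_inv_two_pow_smul_sum {ι : Type*} [Fintype ι] (k : ℕ) (X : ι → Op 1) :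
    acceptProb (((2 : ℂ) ^ k)⁻¹ • ∑ i, X i) = ((2 : ℝ) ^ k)⁻¹ * ∑ i, acceptProb (X i) := by
  have hcast : ((2 : ℂ) ^ k)⁻¹ = (((2 : ℝ) ^ k)⁻¹ : ℝ) := by push_cast; rfl
  simp only [acceptProb, Matrix.smul_apply, Matrix.sum_apply, smul_eq_mul]
  rw [hcast, Complex.re_ofReal_mul, Complex.re_sum]

lemma IsPRS.negligible_acceptProb_sub_maxMixed {pp : ℕ → List ℕ} {N κ : ℕ → ℕ}
    {ψ : ∀ n, Bits (κ n) → (Bits (N n) → ℂ)} (hψ : IsPRS pp N κ ψ)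
    {A : ∀ n, Op (N n) → Op 1} (hA : Efficient pp N (fun _ => 1) A) :
    Negligible fun n => acceptProb (A n (((2 : ℂ) ^ κ n)⁻¹ • ∑ k, ketBra (ψ n k))) -
      acceptProb (A n (maxMixed (N n))) := by
  obtain ⟨L, hL⟩ := hA.exists_linear
  convert hψ.pseudorandom (fun _ => 1) ⟨1, fun n => by simp⟩ _
    (hA.castOp_left fun n => one_mul (N n)) using 2 with n
  simp only [castOp_ketBra_copies_one, hL, integral_acceptProb_haarState, map_smul, map_sum,
    acceptProb_inv_two_pow_smul_sum]

lemma IsPRS.exists_efficient_mixture {m κ N : ℕ → ℕ} {ψ : ∀ n, Bits (κ n) → (Bits (N n) → ℂ)}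
    (hψ : IsPRS (params m κ) N κ ψ) :
    ∃ G : ∀ n, Op 0 → Op (N n), Efficient (params m κ) (fun _ => 0) N G ∧
      ∀ n, G n 1 = ((2 : ℂ) ^ κ n)⁻¹ • ∑ k, ketBra (ψ n k) := by
  obtain ⟨G, hG, hGψ⟩ := hψ.generation
  obtain ⟨L, hL⟩ := hG.exists_linear
  refine ⟨_, hG.comp (efficient_maxMixed (params m κ) (polyTime_ladder_third 0)), fun n => ?_⟩
  change G n ((1 : Op 0) default default • maxMixed (κ n)) = _
  rw [Matrix.one_apply_eq, one_smul, maxMixed_eq_smul_sum_basisState, hL, map_smul, map_sum]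
  simp only [← hL, hGψ]

lemma traceOut_smul_sum {n m : ℕ} {ι : Type*} [Fintype ι] (c : ℂ) (X : ι → Op (n + m)) :
    traceOut (c • ∑ i, X i) = c • ∑ i, traceOut (X i) := by
  ext a b
  simp only [traceOut, Matrix.of_apply, Matrix.smul_apply, Matrix.sum_apply, ← Finset.smul_sum]
  rw [Finset.sum_comm]

lemma prdmPair_false {m κ : ℕ → ℕ} (ψ : ∀ n, Bits (κ n) → (Bits (n + m n) → ℂ)) (n : ℕ) :
    prdmPair ψ false n = traceOut (((2 : ℂ) ^ κ n)⁻¹ • ∑ k, ketBra (ψ n k)) :=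
  (traceOut_smul_sum _ _).symm

lemma traceOut_maxMixed (n m : ℕ) : traceOut (maxMixed (n + m)) = maxMixed n := by
  ext a b
  have hiff (z : Bits m) : Fin.append a z = Fin.append b z ↔ a = b :=
    ⟨fun h => congrArg Prod.fst
      ((Fin.appendEquiv n m).injective (a₁ := (a, z)) (a₂ := (b, z)) h), fun h => h ▸ rfl⟩
  simp only [traceOut, maxMixed, Matrix.of_apply, Matrix.smul_apply, Matrix.one_apply,
    smul_eq_mul, hiff, Finset.sum_const, Finset.card_univ, nsmul_eq_mul, Fintype.card_pi,
    Fintype.card_bool, Finset.prod_const, Fintype.card_fin, pow_add, Nat.cast_pow,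
    Nat.cast_ofNat]
  field_simp

lemma IsNoiseRate.efficient {m κ : ℕ → ℕ} {p : ℕ → ℝ} (hp : IsNoiseRate (params m κ) p) :
    Efficient (params m κ) (fun n => n) (fun n => n) fun n => localDepolarizing (p n) n := by
  obtain ⟨hp01, ⟨q, hq⟩ | h⟩ := hp
  · obtain rfl : p = fun _ => q := funext hq
    exact efficient_localDepolarizing (hp01 0).1 (hp01 0).2 m κ
  · exact h

theorem robustEFI_of_entropy {m κ : ℕ → ℕ} {ψ : ∀ n, Bits (κ n) → (Bits (n + m n) → ℂ)}
    {p : ℕ → ℝ} (hψ : IsPRS (params m κ) (fun n => n + m n) κ ψ)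
    (hp : IsNoiseRate (params m κ) p)
    (hent : ∀ᶠ n : ℕ in atTop,
      κ n + m n + n * shannonEntropy (depolWeight (p n)) ≤ (n : ℝ) - 2) :
    RobustEFI ψ p := by
  have hnoise := hp.efficient.comp (efficient_traceOut m κ)
  refine ⟨fun b => ?_, ⟨2, ?_⟩, fun A hA => ?_⟩
  · cases b
    · obtain ⟨G, hG, hGψ⟩ := hψ.exists_efficient_mixture
      exact ⟨_, hnoise.comp hG, fun n => by rw [hGψ, prdmPair_false]⟩
    · refine ⟨_, efficient_maxMixed (params m κ) (polyTime_ladder_first 0), fun n => ?_⟩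
      rw [prdmPair, localDepolarizing_maxMixed, Matrix.one_apply_eq, one_smul]
      rfl
  · filter_upwards [hent, eventually_ge_atTop 2] with n hn hn2
    simp only [prdmPair, localDepolarizing_maxMixed]
    refine le_trans ?_ (inv_two_mul_le_traceNorm_localDepolarizing (hp.1 n).1 (hp.1 n).2
      (hψ.unit n) hn)
    have : (2 : ℝ) ≤ n := by exact_mod_cast hn2
    rw [one_div]
    exact inv_anti₀ (by linarith) (by nlinarith)
  · convert hψ.negligible_acceptProb_sub_maxMixed (hA.comp hnoise) using 4 with n
    · rw [prdmPair_false]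
    · rw [traceOut_maxMixed, prdmPair]

end Robustness

/-! ### The entropy of the noise -/

section NoiseEntropy

lemma shannonEntropy_depolWeight (p : ℝ) :
    shannonEntropy (depolWeight p) = Real.qaryEntropy 4 (3 * p / 4) / Real.log 2 := by
  have hlog : p * Real.log (3 * p / 4) = p * Real.log 3 + p * Real.log (p / 4) := by
    rcases eq_or_ne p 0 with rfl | hp
    · simp
    · rw [mul_div_assoc, Real.log_mul three_ne_zero (div_ne_zero hp four_ne_zero), mul_add]
  have h3 : ((4 - 1 : ℤ) : ℝ) = 3 := by norm_num
  rw [shannonEntropy, ← Finset.sum_div, Real.qaryEntropy, Nat.cast_ofNat, h3,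
    Real.binEntropy_eq_negMulLog_add_negMulLog_one_sub]
  simp only [Fin.sum_univ_four, depolWeight, Matrix.cons_val, Real.negMulLog]
  congr 1
  linear_combination (3 / 4) * hlog

lemma shannonEntropy_depolWeight_le_of_le {p q : ℝ} (h0 : 0 ≤ p) (hpq : p ≤ q) (hq : q ≤ 1) :
    shannonEntropy (depolWeight p) ≤ shannonEntropy (depolWeight q) := by
  rw [shannonEntropy_depolWeight, shannonEntropy_depolWeight]
  have hmono := (Real.qaryEntropy_strictMonoOn (q := 4) (by norm_num)).monotoneOn
  refine div_le_div_of_nonneg_right (hmono ?_ ?_ ?_) (Real.log_pos one_lt_two).le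
  · constructor <;> norm_num <;> linarith
  · constructor <;> norm_num <;> linarith
  · linarith

lemma shannonEntropy_depolWeight_quarter_le : shannonEntropy (depolWeight (1 / 4)) ≤ 0.99375 := by
  have hlog2 : 0 < Real.log 2 := Real.log_pos one_lt_two
  have hlog16 : Real.log 16 = 4 * Real.log 2 := by
    rw [show (16 : ℝ) = 2 ^ 4 by norm_num, Real.log_pow]
    norm_num
  have hlog13 : 37 * Real.log 2 ≤ 10 * Real.log 13 := by
    have := Real.log_le_log (x := 2 ^ 37) (y := 13 ^ 10) (by norm_num) (by norm_num)
    rw [Real.log_pow, Real.log_pow] at this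
    exact_mod_cast this
  have hweight : depolWeight (1 / 4) = ![13 / 16, 1 / 16, 1 / 16, 1 / 16] := by
    norm_num [depolWeight]
  rw [shannonEntropy, ← Finset.sum_div, div_le_iff₀ hlog2, hweight]
  simp only [Fin.sum_univ_four, Matrix.cons_val, Real.negMulLog]
  rw [Real.log_div (by norm_num) (by norm_num), one_div, Real.log_inv, hlog16]
  linarith

end NoiseEntropy

section KeyLength

lemma isLittleO_natCast_of_le_mul_log_pow {f : ℕ → ℝ} (hf : ∀ n, 0 ≤ f n) {a : ℝ} {e : ℕ}
    (hle : ∀ᶠ n : ℕ in atTop, f n ≤ a * Real.log n ^ e) :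
    f =o[atTop] fun n : ℕ => (n : ℝ) := by
  have hlog : (fun n : ℕ => a * Real.log n ^ e) =o[atTop] fun n : ℕ => (n : ℝ) :=
    (Real.isLittleO_pow_log_id_atTop.const_mul_left a).comp_tendsto tendsto_natCast_atTop_atTop
  refine (Asymptotics.IsBigO.of_bound' ?_).trans_isLittleO hlog
  filter_upwards [hle] with n hn
  exact abs_le_abs_of_nonneg (hf n) hn

lemma eventually_entropy_le {m κ : ℕ → ℕ} {p : ℕ → ℝ} {c q : ℝ}
    (hm : (fun n => (m n : ℝ)) =o[atTop] fun n : ℕ => (n : ℝ))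
    (hκ : ∀ᶠ n : ℕ in atTop, (κ n : ℝ) ≤ c * (n + m n)) (hp0 : ∀ n, 0 ≤ p n)
    (hpq : ∀ᶠ n : ℕ in atTop, p n ≤ q) (hq : q ≤ 1)
    (hc : c + shannonEntropy (depolWeight q) < 1) :
    ∀ᶠ n : ℕ in atTop, κ n + m n + n * shannonEntropy (depolWeight (p n)) ≤ (n : ℝ) - 2 := by
  have hconst : (fun _ : ℕ => (2 : ℝ)) =o[atTop] fun n : ℕ => (n : ℝ) :=
    (Asymptotics.isLittleO_const_id_atTop 2).comp_tendsto tendsto_natCast_atTop_atTop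
  have hsmall := ((hm.const_mul_left (1 + c)).add hconst).bound (sub_pos.2 hc)
  filter_upwards [hsmall, hκ, hpq] with n hn hκn hpn
  have hH := mul_le_mul_of_nonneg_left (shannonEntropy_depolWeight_le_of_le (hp0 n) hpn hq)
    n.cast_nonneg (α := ℝ)
  rw [Real.norm_natCast] at hn
  have := (le_abs_self _).trans hn
  linarith

lemma mul_le_of_le_sub_div_sub_div {n x a b d : ℝ} (hn : 0 < n) (hx : x ≤ a - b / n - d / n) :
    n * x ≤ n * a - b - d := by
  refine (mul_le_mul_of_nonneg_left hx hn.le).trans_eq ?_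
  field_simp

end KeyLength

end NoisyEFI

open NoisyEFI in
theorem mainTheorem10_general {m κ : ℕ → ℕ} {ψ : ∀ n, Bits (κ n) → (Bits (n + m n) → ℂ)}
    {p : ℕ → ℝ} (hψ : IsPRS (params m κ) (fun n => n + m n) κ ψ)
    (hp : IsNoiseRate (params m κ) p) :
    ((∀ᶠ n : ℕ in atTop,
        κ n + m n + n * shannonEntropy (depolWeight (p n)) ≤ (n : ℝ) - 2) → RobustEFI ψ p) ∧
      ∀ c q : ℝ, (fun n => (m n : ℝ)) =o[atTop] (fun n : ℕ => (n : ℝ)) →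
        (∀ᶠ n : ℕ in atTop, (κ n : ℝ) ≤ c * (n + m n)) → (∀ᶠ n : ℕ in atTop, p n ≤ q) → q ≤ 1 →
        c + shannonEntropy (depolWeight q) < 1 → RobustEFI ψ p :=
  ⟨robustEFI_of_entropy hψ hp, fun _ _ hm hκ hpq hq hc => robustEFI_of_entropy hψ hp
    (eventually_entropy_le hm hκ (fun n => (hp.1 n).1) hpq hq hc)⟩

theorem mainTheorem10 :
    (∀ (c : ℝ) (m κ : ℕ → ℕ)
      (ψ : ∀ n, NoisyEFI.Bits (κ n) → (NoisyEFI.Bits (n + m n) → ℂ)) (p : ℕ → ℝ),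
      0 < c → c < 1 →
      Tendsto (fun n : ℕ => (m n : ℝ) / Real.log n) atTop atTop →
      NoisyEFI.IsPRS (NoisyEFI.params m κ) (fun n => n + m n) κ ψ →
      NoisyEFI.IsNoiseRate (NoisyEFI.params m κ) p →
      ((∀ n : ℕ, κ n = ⌊c * n⌋₊) ∧
          ∀ᶠ n : ℕ in atTop, NoisyEFI.shannonEntropy (NoisyEFI.depolWeight (p n)) ≤
            (1 - c) - (m n : ℝ) / n - 2 / n) ∨
        ((∀ n : ℕ, κ n = ⌊c * (n + m n)⌋₊) ∧
          ∀ᶠ n : ℕ in atTop, NoisyEFI.shannonEntropy (NoisyEFI.depolWeight (p n)) ≤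
            (1 - c) - (1 + c) * (m n : ℝ) / n - 2 / n) →
      NoisyEFI.RobustEFI ψ p) ∧
    (∀ m : ℕ → ℕ,
      Tendsto (fun n : ℕ => (m n : ℝ) / Real.log n) atTop atTop →
      (∃ (a : ℝ) (e : ℕ), ∀ᶠ n : ℕ in atTop, (m n : ℝ) ≤ a * Real.log n ^ e) →
      ∃ (C : ℝ) (d : ℕ), 0 ≤ C ∧
        ∀ (κ : ℕ → ℕ) (ψ : ∀ n, NoisyEFI.Bits (κ n) → (NoisyEFI.Bits (n + m n) → ℂ))
          (p : ℕ → ℝ),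
          ((∀ n : ℕ, κ n = ⌊(10 : ℝ) ^ (-4 : ℤ) * n⌋₊) ∨
            (∀ n : ℕ, κ n = ⌊(10 : ℝ) ^ (-4 : ℤ) * (n + m n)⌋₊)) →
          NoisyEFI.IsPRS (NoisyEFI.params m κ) (fun n => n + m n) κ ψ →
          NoisyEFI.IsNoiseRate (NoisyEFI.params m κ) p →
          (∀ᶠ n : ℕ in atTop, p n < 1 / 4 - C * Real.log n ^ d / n) →
          NoisyEFI.RobustEFI ψ p) := by
  refine ⟨fun c m κ ψ p hc0 _ _ hψ hp h => (mainTheorem10_general hψ hp).1 ?_,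
    fun m _ ⟨a, e, hm⟩ => ⟨0, 0, le_rfl, fun κ ψ p hκ hψ hp hlt => ?_⟩⟩
  · rcases h with ⟨hκ, hH⟩ | ⟨hκ, hH⟩
    · filter_upwards [hH, eventually_gt_atTop 0] with n hn hpos
      have hfloor : (κ n : ℝ) ≤ c * n := hκ n ▸ Nat.floor_le (by positivity)
      linarith [NoisyEFI.mul_le_of_le_sub_div_sub_div (Nat.cast_pos.2 hpos) hn]
    · filter_upwards [hH, eventually_gt_atTop 0] with n hn hpos
      have hfloor : (κ n : ℝ) ≤ c * (n + m n) := hκ n ▸ Nat.floor_le (by positivity)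
      linarith [NoisyEFI.mul_le_of_le_sub_div_sub_div (Nat.cast_pos.2 hpos) hn]
  · refine (mainTheorem10_general hψ hp).2 (10 ^ (-4 : ℤ)) (1 / 4)
      (NoisyEFI.isLittleO_natCast_of_le_mul_log_pow (fun n => (m n).cast_nonneg) hm)
      (.of_forall fun n => ?_) (hlt.mono fun n hn => ?_) (by norm_num) ?_
    · rcases hκ with hκ | hκ <;> rw [hκ]
      · exact (Nat.floor_le (by positivity)).trans (by gcongr; simp)
      · exact Nat.floor_le (by positivity)
    · simpa using hn.le
    · have := NoisyEFI.shannonEntropy_depolWeight_quarter_le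
      norm_num at this ⊢
      linarith
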